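/- Let $n\ge 0$. Write $[\pm n]=\{\pm1,\dots,\pm n\}$, and let $B_n$ be the group of signed permutations, i.e. permutations $\pi$ of $[\pm n]$ with $\pi(-i)=-\pi(i)$, with simple reflections $s_0=(1\;{-1})$ and $s_i=(i\;\,i{+}1)(-i\;\,{-i}{-}1)$ for $1\le i\le n-1$. Order $B_n$ by the (right) weak order: $u\le w$ if and only if $\operatorname{inv}(u)\subseteq\operatorname{inv}(w)$, where $\operatorname{inv}(w)$ is the set of reflections $t$ with $\ell(tw)<\ell(w)$; this is a finite lattice. An element $j$ is join-irreducible if it covers exactly one element. A lattice congruence contracts $x$ if $x$ is congruent to some element strictly less than $x$. A join-irreducible element $j_1$ forces a join-irreducible element $j_2$ if every lattice congruence on the weak order that contracts $j_1$ also contracts $j_2$. Arcs. Place points labelled $-n,\dots,-1,1,\dots,n$ on a vertical line, from bottom to top. All intervals below are intervals in $[\pm n]$. An arc $\alpha$ with endpoints $p<q$ is a curve moving monotonically down from $q$ to $p$ and passing to the left or to the right of each point strictly between. Arcs are considered up to combinatorial equivalence, so that $\alpha$ is given by $p$, $q$ and the set $R(\alpha)\subseteq(p,q)$ of points to the right of $\alpha$;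 put $L(\alpha)=(p,q)\setminus R(\alpha)$. The half turn sending each $i$ to $-i$ sends $\alpha$ to the arc $-\alpha$ with endpoints $-q<-p$ and $R(-\alpha)=-L(\alpha)$. Two arcs are compatible if they share neither their top nor their bottom endpoint and can be drawn so as not to intersect except possibly at one common endpoint. A symmetric arc is an arc $\alpha$ with $-\alpha=\alpha$. A symmetric pair is a set $\{\alpha,-\alpha\}$ with $\alpha$ and $-\alpha$ compatible; it is overlapping if each of the two arcs joins a positive point to a negative point (one of the two arcs is then right of the other), and non-overlapping otherwise. Arcs of join-irreducible elements. For a join-irreducible $j\in B_n$, draw one arc for each descent of its long one-line notation $j_{-n}\cdots j_{-1}j_1\cdots j_n$. The arc of a descent $b>a$ (adjacent entries, $b$ immediately before $a$) has endpoints $a<b$, and its right (resp. left) points are the values strictly between $a$ and $b$ that occur after (resp. before) the descent. The result $A(j)$ is a single symmetric arc or a symmetric pair. Subarcs. (1) Let $\alpha$ be a symmetric arc with endpoints $-p<p$. A subarc of $\alpha$ is a symmetric arc $\alpha'$ with endpoints $-p'<p'$ such that $p'\le p$ and $R(\alpha')=R(\alpha)\cap(-p',p')$. A subarc pair of $\alpha$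 is a non-overlapping symmetric pair $\{\alpha',-\alpha'\}$ such that $\alpha'$ has endpoints $p',q'$ with $0<p'<q'\le p$ and $R(\alpha')=R(\alpha)\cap(p',q')$. (2) Let $\{\alpha,-\alpha\}$ be a symmetric pair, where $\alpha$ has endpoints $p<q$. A subarc of $\{\alpha,-\alpha\}$ is a symmetric arc $\alpha'$ with endpoints $-p'<p'$ such that $p\le -p'<p'\le q$ and $R(\alpha')=R(\alpha)\cap(-p',p')=R(-\alpha)\cap(-p',p')$. If $\{\alpha,-\alpha\}$ is overlapping, suppose further that $\alpha$ is right of $-\alpha$. A subarc pair of $\{\alpha,-\alpha\}$ is a symmetric pair $\{\alpha',-\alpha'\}$ such that $\alpha'$ has endpoints $p',q'$ with $p\le p'<q'\le q$ and $R(\alpha')=R(\alpha)\cap(p',q')$, satisfying the additional requirement that, if $\{\alpha',-\alpha'\}$ is overlapping, then $\alpha'$ is also right of $-\alpha'$. Theorem. Let $j_1$ and $j_2$ be join-irreducible elements of $B_n$. Then $j_1$ forces $j_2$ if and only if $A(j_1)$ is a subarc or subarc pair of $A(j_2)$. -/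

import Mathlib

/-! ### Congruences and forcing -/

namespace Forcing

variable {L : Type*} [Preorder L]

/-- `j` is join-irreducible: it covers exactly one element. -/
def IsJoinIrred (j : L) : Prop := ∃! x, x ⋖ j

/-- `Θ` is compatible with the meets and joins of `L`. Meets and joins enter through `IsGLB` and
`IsLUB`, so that for a lattice this is the usual notion of a lattice congruence, without the
lattice operations of `L` having to be chosen. -/
def IsCongruence (Θ : Setoid L) : Prop :=
  ∀ x₁ x₂ y₁ y₂ : L, Θ x₁ x₂ → Θ y₁ y₂ →
    (∀ m₁ m₂, IsGLB {x₁, y₁} m₁ → IsGLB {x₂, y₂} m₂ → Θ m₁ m₂) ∧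
    (∀ m₁ m₂, IsLUB {x₁, y₁} m₁ → IsLUB {x₂, y₂} m₂ → Θ m₁ m₂)

/-- `x` is contracted by `Θ`: it is congruent to some strictly smaller element. -/
def Contracts (Θ : Setoid L) (x : L) : Prop := ∃ y, y < x ∧ Θ x y

/-- `j₁` forces `j₂`: every congruence that contracts `j₁` also contracts `j₂`. -/
def Forces (j₁ j₂ : L) : Prop :=
  ∀ Θ : Setoid L, IsCongruence Θ → Contracts Θ j₁ → Contracts Θ j₂

end Forcing

namespace TypeB

/-! ### Signed permutations and the weak order -/

/-- The set `{±1, …, ±n}`, with the order inherited from `ℤ`. -/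
abbrev Pt (n : ℕ) : Type := {i : ℤ // i ≠ 0 ∧ |i| ≤ (n : ℤ)}

instance instNegPt (n : ℕ) : Neg (Pt n) :=
  ⟨fun i => ⟨-i.1, neg_ne_zero.mpr i.2.1, by rw [abs_neg]; exact i.2.2⟩⟩

theorem Pt.coe_neg {n : ℕ} (i : Pt n) : ((-i : Pt n) : ℤ) = -(i : ℤ) := rfl

theorem Pt.neg_neg {n : ℕ} (i : Pt n) : - -i = i := Subtype.ext (_root_.neg_neg (i : ℤ))

theorem Pt.neg_lt_neg {n : ℕ} {i j : Pt n} (h : i < j) : -j < -i :=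
  _root_.neg_lt_neg (a := (i : ℤ)) (b := (j : ℤ)) h

/-- The Coxeter group of type `B_n`: the permutations `π` of `{±1, …, ±n}` such that
`π (-i) = - π i` for all `i`. -/
def signedPerms (n : ℕ) : Subgroup (Equiv.Perm (Pt n)) where
  carrier := {π | ∀ i, π (-i) = -π i}
  one_mem' := fun _ => rfl
  mul_mem' := by
    intro a b ha hb i
    rw [Equiv.Perm.mul_apply, Equiv.Perm.mul_apply, hb i, ha]
  inv_mem' := by
    intro a ha i
    rw [Equiv.Perm.inv_eq_iff_eq, ha]
    exact congrArg (fun x => -x) (a.apply_symm_apply i).symm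

/-- The type of elements of `B_n`. -/
abbrev SignedPerm (n : ℕ) : Type := ↥(signedPerms n)

/-- `s` is one of the simple reflections `s_0 = (1 -1)` and `s_i = (i i+1)(-i -(i+1))` for
`1 ≤ i ≤ n - 1`. -/
def IsSimple {n : ℕ} (s : SignedPerm n) : Prop :=
  (∃ i : Pt n, (i : ℤ) = 1 ∧ (s : Equiv.Perm (Pt n)) = Equiv.swap i (-i)) ∨
  (∃ i j : Pt n, 0 < (i : ℤ) ∧ (j : ℤ) = (i : ℤ) + 1 ∧
    (s : Equiv.Perm (Pt n)) = Equiv.swap i j * Equiv.swap (-i) (-j))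

/-- `t` is one of the reflections `(i -i)` and `(i j)(-i -j)` with `|i| ≠ |j|`. -/
def IsReflection {n : ℕ} (t : SignedPerm n) : Prop :=
  (∃ i : Pt n, (t : Equiv.Perm (Pt n)) = Equiv.swap i (-i)) ∨
  (∃ i j : Pt n, |(i : ℤ)| ≠ |(j : ℤ)| ∧
    (t : Equiv.Perm (Pt n)) = Equiv.swap i j * Equiv.swap (-i) (-j))

/-- The length of `w`: the least length of a word in the simple reflections with product `w`. -/
noncomputable def length {n : ℕ} (w : SignedPerm n) : ℕ :=
  sInf {k | ∃ l : List (SignedPerm n), (∀ s ∈ l, IsSimple s) ∧ l.prod = w ∧ l.length = k}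

/-- The set of (left) inversions of `w`. -/
def inversions {n : ℕ} (w : SignedPerm n) : Set (SignedPerm n) :=
  {t | IsReflection t ∧ length (t * w) < length w}

/-- The (right) weak order on `B_n`: `u ≤ w` if and only if `inversions u ⊆ inversions w`. -/
noncomputable instance weakOrder (n : ℕ) : Preorder (SignedPerm n) :=
  Preorder.lift inversions

/-! ### Arcs -/

/-- An arc on the points `-n, …, -1, 1, …, n` of a vertical line, up to combinatorial equivalence:
it moves monotonically from its top endpoint down to its bottom endpoint, and it is given by its
endpoints and by the set of the numbered points strictly between them that lie to the right of
the arc. -/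
@[ext]
structure Arc (n : ℕ) where
  bot : Pt n
  top : Pt n
  bot_lt_top : bot < top
  /-- `R(α)` -/
  right : Set (Pt n)
  right_subset : right ⊆ Set.Ioo bot top

namespace Arc

variable {n : ℕ}

/-- `L(α)`, the set of numbered points between the endpoints that are to the left of the arc. -/
def left (α : Arc n) : Set (Pt n) := Set.Ioo α.bot α.top \ α.right

/-- The image `-α` of an arc under the half turn that sends `i` to `-i`. The half turn exchanges
top and bottom, and left and right. -/
instance instNegArc : Neg (Arc n) :=
  ⟨fun α =>
    { bot := -α.top
      top := -α.bot
      bot_lt_top := Pt.neg_lt_neg α.bot_lt_top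
      right := {i | -i ∈ α.left}
      right_subset := by
        intro i hi
        have h := hi.1
        have h1 := Pt.neg_lt_neg h.1
        have h2 := Pt.neg_lt_neg h.2
        rw [Pt.neg_neg] at h1 h2
        exact ⟨h2, h1⟩ }⟩

open Classical in
/-- The horizontal position of the arc at the height of the numbered point `i`, relative to that
point: `-1` if the arc passes left of `i`, `1` if it passes right of `i`, and `0` if `i` is an
endpoint (used only for `i` between the endpoints, inclusively). -/
noncomputable def side (α : Arc n) (i : Pt n) : ℤ :=
  if i ∈ α.right then -1 else if i ∈ α.left then 1 else 0

/-- At the height of each numbered point that both arcs reach, `α` is not left of `β`. Equivalently,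
the two arcs can be drawn without crossing and with `α` to the right of `β` wherever both are
present (except at a common endpoint). -/
def IsRightOf (α β : Arc n) : Prop :=
  ∀ i : Pt n, i ∈ Set.Icc α.bot α.top → i ∈ Set.Icc β.bot β.top → β.side i ≤ α.side i

/-- Two arcs are compatible: they share neither their top endpoint nor their bottom endpoint, and
they do not intersect except possibly at one common endpoint. Up to combinatorial equivalence, the
latter means that one of them is right of the other wherever both are present. -/
def Compatible (α β : Arc n) : Prop :=
  α.top ≠ β.top ∧ α.bot ≠ β.bot ∧ (IsRightOf α β ∨ IsRightOf β α)

/-- `α` is a symmetric arc. -/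
def IsSymm (α : Arc n) : Prop := -α = α

/-- `{α, -α}` is a symmetric pair of arcs. -/
def IsPair (α : Arc n) : Prop := Compatible α (-α)

/-- `α` connects a positive point to a negative point; for a symmetric pair `{α, -α}`, this says
that the pair is overlapping. -/
def IsOverlapping (α : Arc n) : Prop := (α.bot : ℤ) < 0 ∧ 0 < (α.top : ℤ)

/-- For a symmetric arc `α`: the symmetric arc `α'` is a subarc of `α`. -/
def IsSubarcOfSymm (α' α : Arc n) : Prop :=
  α'.IsSymm ∧ α'.top ≤ α.top ∧ α'.right = α.right ∩ Set.Ioo α'.bot α'.top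

/-- For a symmetric arc `α`: the non-overlapping pair `{α', -α'}`, with `α'` above `-α'`, is a
subarc pair of `α`. -/
def IsSubpairOfSymm (α' α : Arc n) : Prop :=
  α'.IsPair ∧ 0 < (α'.bot : ℤ) ∧ α'.top ≤ α.top ∧
    α'.right = α.right ∩ Set.Ioo α'.bot α'.top

/-- For a symmetric pair `{α, -α}`: the symmetric arc `α'` is a subarc of `{α, -α}`. -/
def IsSubarcOfPair (α' α : Arc n) : Prop :=
  α'.IsSymm ∧ α.bot ≤ α'.bot ∧ α'.top ≤ α.top ∧
    α'.right = α.right ∩ Set.Ioo α'.bot α'.top ∧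
    α'.right = (-α).right ∩ Set.Ioo α'.bot α'.top

/-- For a symmetric pair `{α, -α}`, where `α` is right of `-α` if the pair is overlapping: the
symmetric pair `{α', -α'}` is a subarc pair of `{α, -α}`. The last clause is the additional
requirement on overlapping subarc pairs. -/
def IsSubpairOfPair (α' α : Arc n) : Prop :=
  α'.IsPair ∧ (α.IsOverlapping → IsRightOf α (-α)) ∧
    α.bot ≤ α'.bot ∧ α'.top ≤ α.top ∧
    α'.right = α.right ∩ Set.Ioo α'.bot α'.top ∧
    (α'.IsOverlapping → IsRightOf α' (-α'))

end Arc

/-- `A₁` is a subarc or subarc pair of `A₂`. A symmetric arc `α` is represented by the set `{α}`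
and a symmetric pair by the set `{α, -α}`. -/
def IsSubarcOrSubpair {n : ℕ} (A₁ A₂ : Set (Arc n)) : Prop :=
  (∃ α : Arc n, α.IsSymm ∧ A₂ = {α} ∧
    ((∃ α' : Arc n, A₁ = {α'} ∧ α'.IsSubarcOfSymm α) ∨
     (∃ α' : Arc n, A₁ = {α', -α'} ∧ α'.IsSubpairOfSymm α))) ∨
  (∃ α : Arc n, α.IsPair ∧ A₂ = {α, -α} ∧
    ((∃ α' : Arc n, A₁ = {α'} ∧ α'.IsSubarcOfPair α) ∨
     (∃ α' : Arc n, A₁ = {α', -α'} ∧ α'.IsSubpairOfPair α)))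

/-- The arc diagram `δ(π)` of a signed permutation: the set with one arc for each descent of the
long one-line notation `π_{-n} ⋯ π_{-1} π_1 ⋯ π_n`. The arc of a descent `π_i > π_{i'}`, where `i`
and `i'` are consecutive positions, has endpoints `π_i` and `π_{i'}`; the right points are the
values strictly between them that occur after position `i'`. For a join-irreducible `π`, this is
the symmetric arc `{α}` or the symmetric pair `{α, -α}` corresponding to `π`. -/
def arcDiagram {n : ℕ} (π : SignedPerm n) : Set (Arc n) :=
  {α | ∃ i i' : Pt n, i ⋖ i' ∧ α.top = π.1 i ∧ α.bot = π.1 i' ∧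
    α.right = {v | v ∈ Set.Ioo (π.1 i') (π.1 i) ∧ i' < π.1.symm v}}

end TypeB

/-! In the long one-line notation, the inversions of `w` are the pairs of values `a < b` with `b`
before `a`, so the weak order is containment of sets of inverted pairs. An arc `α` imposes two kinds
of conditions on such a set. `Below α w` asks that every pair `a < b` with `a` the bottom endpoint
or a right point and `b` the top endpoint or a left point be inverted. `Above α w` asks that every
pair with left and right exchanged be non-inverted. For the arcs that represent join-irreducible
elements (`Adm` picks a representative among `α`, `-α`), the first condition defines the principal
filter of the join-irreducible element `j`, and the second a principal ideal with greatest element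
`m`. The antiautomorphism `w ↦ w₀ w`, together with `rev` on arcs, exchanges the two conditions.

Forcing implies subarc. Fix the arc `α` of `j₂` and relate two elements when the same subarcs of `α`
are `Below` them. This respects meets, because each condition is a principal filter. The key lemma
`Good.exists_isSub_below` says that when `Above β w` fails, some subarc of `β`, whose endpoints are
themselves a pair that must not be inverted, is `Below w`. Hence the relation is equally described
by `Above`, and it respects joins. The resulting congruence does not contract `j₂`, but it contracts
every join-irreducible element whose arc is not, up to sign, a subarc of `α`: such an element and
its lower cover have the same subarcs of `α` below them.

Subarc implies forcing. Contraction propagates along arrows (`Contracted.step`): if the lower cover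
`j'` of the element `j` of `α` lies below the `m` of `β` but `j` does not, then `j ≡ j'` yields `m ≡
m ∨ j`, and `m ∨ j` lies in the filter of `β`. For a restriction `α` of `β` there is such an arrow
if the bottom of `α` is the bottom or a left point of `β` and its top is the top or a right point of
`β`, apart from a side condition caused by the symmetry `v ↦ -v`; the dual statement exchanges left
and right. A general subarc is reached from `α` by a few arrows, mostly moving one end at a time.
The last part matches `IsSub` with the subarcs and subarc pairs of the statement. -/

namespace TypeB

variable {n : ℕ}

/-! ### Signed permutations: positions and reflections -/

theorem Pt.ext' {a b : Pt n} (h : (a : ℤ) = b) : a = b := Subtype.ext h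

theorem Pt.ne_zero (a : Pt n) : (a : ℤ) ≠ 0 := a.2.1

theorem Pt.eq_iff {a b : Pt n} : a = b ↔ (a : ℤ) = b := Subtype.ext_iff

theorem Pt.lt_iff {a b : Pt n} : a < b ↔ (a : ℤ) < b := Iff.rfl

theorem Pt.le_iff {a b : Pt n} : a ≤ b ↔ (a : ℤ) ≤ b := Iff.rfl

theorem Pt.neg_eq_iff {a b : Pt n} : -a = b ↔ -(a : ℤ) = b := Subtype.ext_iff

instance : Finite (Pt n) :=
  Set.Finite.to_subtype ((Set.finite_Icc (-(n : ℤ)) n).subset fun _ hi => abs_le.mp hi.2)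

/-- The position of the value `v` in the long one-line notation of `w`. -/
def pos (w : SignedPerm n) (v : Pt n) : ℤ := (w.1.symm v : Pt n)

theorem pos_neg (w : SignedPerm n) (v : Pt n) : pos w (-v) = -pos w v := by
  have h : w.1.symm (-v) = -w.1.symm v := (w⁻¹).2 v
  rw [pos, h]; rfl

theorem pos_inj (w : SignedPerm n) {u v : Pt n} (h : pos w u = pos w v) : u = v :=
  w.1.symm.injective (Pt.ext' h)

theorem pos_apply (w : SignedPerm n) (i : Pt n) : pos w (w.1 i) = i := by simp [pos]

theorem pos_mul (t w : SignedPerm n) (v : Pt n) : pos (t * w) v = pos w (t.1.symm v) := rfl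

theorem apply_neg (w : SignedPerm n) (i : Pt n) : w.1 (-i) = -w.1 i := w.2 i

/-- The map exchanging `a` with `b` and `-a` with `-b`. -/
def reflFun (a b v : Pt n) : Pt n :=
  if v = a then b else if v = b then a else if v = -a then -b else if v = -b then -a else v

theorem reflFun_involutive (a b : Pt n) : Function.Involutive (reflFun a b) := by
  intro v
  have := a.ne_zero
  have := b.ne_zero
  grind [reflFun, Pt.eq_iff, Pt.coe_neg]

theorem reflFun_neg (a b v : Pt n) : reflFun a b (-v) = -reflFun a b v := by
  have := a.ne_zero
  have := b.ne_zero
  simp only [reflFun, Pt.eq_iff, Pt.coe_neg]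
  split_ifs <;> (try simp only [Pt.coe_neg] at *) <;> omega

/-- The signed permutation exchanging `a` with `b` and `-a` with `-b`. -/
def refl (a b : Pt n) : SignedPerm n :=
  ⟨(reflFun_involutive a b).toPerm, fun v => reflFun_neg a b v⟩

theorem refl_apply (a b v : Pt n) : (refl a b).1 v = reflFun a b v := rfl

theorem refl_mul_self (a b : Pt n) : refl a b * refl a b = 1 :=
  Subtype.ext (Equiv.ext fun v => reflFun_involutive a b v)

theorem refl_comm (a b : Pt n) : refl a b = refl b a := by
  refine Subtype.ext (Equiv.ext fun v => ?_)
  simp only [refl_apply, reflFun, Pt.eq_iff, Pt.coe_neg]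
  split_ifs <;> (try simp only [Pt.coe_neg] at *) <;> omega

theorem refl_neg_neg (a b : Pt n) : refl (-a) (-b) = refl a b := by
  have := a.ne_zero
  have := b.ne_zero
  refine Subtype.ext (Equiv.ext fun v => ?_)
  simp only [refl_apply, reflFun, Pt.eq_iff, Pt.coe_neg]
  split_ifs <;> (try simp only [Pt.coe_neg] at *) <;> omega

theorem mul_refl (g : SignedPerm n) (a b : Pt n) :
    g * refl a b = refl (g.1 a) (g.1 b) * g := by
  refine Subtype.ext (Equiv.ext fun v => ?_)
  change g.1 (reflFun a b v) = reflFun (g.1 a) (g.1 b) (g.1 v)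
  simp only [reflFun, ← apply_neg, g.1.apply_eq_iff_eq]
  split_ifs <;> rfl

theorem coe_refl_self_neg (a : Pt n) :
    ((refl a (-a) : SignedPerm n) : Equiv.Perm (Pt n)) = Equiv.swap a (-a) := by
  refine Equiv.ext fun v => ?_
  rw [refl_apply, Equiv.swap_apply_def]
  simp only [reflFun, Pt.neg_neg]
  split_ifs <;> simp_all

theorem coe_refl (a b : Pt n) (h : |(a : ℤ)| ≠ |(b : ℤ)|) :
    ((refl a b : SignedPerm n) : Equiv.Perm (Pt n)) = Equiv.swap a b * Equiv.swap (-a) (-b) := by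
  have h1 : (a : ℤ) ≠ b := fun e => h (by rw [e])
  have h2 : (a : ℤ) ≠ -b := fun e => h (by rw [e, abs_neg])
  have := a.ne_zero
  have := b.ne_zero
  refine Equiv.ext fun v => ?_
  rw [refl_apply, Equiv.Perm.mul_apply, Equiv.swap_apply_def, Equiv.swap_apply_def]
  simp only [reflFun, Pt.eq_iff, Pt.coe_neg]
  split_ifs <;> (try simp only [Pt.coe_neg] at *) <;> omega

theorem isReflection_iff (t : SignedPerm n) :
    IsReflection t ↔ ∃ a b : Pt n, (a : ℤ) < b ∧ t = refl a b := by
  constructor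
  · have key : ∀ a b : Pt n, (a : ℤ) ≠ b → ∃ c d : Pt n, (c : ℤ) < d ∧ refl a b = refl c d := by
      intro a b h
      rcases lt_or_gt_of_ne h with h | h
      · exact ⟨a, b, h, rfl⟩
      · exact ⟨b, a, h, refl_comm a b⟩
    rintro (⟨i, h⟩ | ⟨i, j, hij, h⟩)
    · obtain ⟨c, d, hcd, e⟩ := key i (-i) (by have := i.ne_zero; rw [Pt.coe_neg]; omega)
      exact ⟨c, d, hcd, e ▸ Subtype.ext (h.trans (coe_refl_self_neg i).symm)⟩
    · obtain ⟨c, d, hcd, e⟩ := key i j (fun e => hij (by rw [e]))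
      exact ⟨c, d, hcd, e ▸ Subtype.ext (h.trans (coe_refl i j hij).symm)⟩
  · rintro ⟨a, b, hab, rfl⟩
    by_cases h : |(a : ℤ)| = |(b : ℤ)|
    · have : b = -a := Pt.ext' (by rw [Pt.coe_neg]; rcases abs_eq_abs.mp h with h | h <;> omega)
      subst this
      exact Or.inl ⟨a, coe_refl_self_neg a⟩
    · exact Or.inr ⟨a, b, h, coe_refl a b h⟩

/-! ### Adjacent positions and simple reflections -/

theorem covBy_iff {i k : Pt n} :
    i ⋖ k ↔ (i : ℤ) < k ∧ ∀ v : Pt n, ¬((i : ℤ) < v ∧ (v : ℤ) < k) :=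
  ⟨fun h => ⟨h.1, fun _ hv => h.2 hv.1 hv.2⟩, fun h => ⟨h.1, fun v h1 h2 => h.2 v ⟨h1, h2⟩⟩⟩

theorem covBy_neg {i k : Pt n} (h : i ⋖ k) : -k ⋖ -i := by
  rw [covBy_iff] at h ⊢
  refine ⟨by simp only [Pt.coe_neg]; omega, fun v hv => h.2 (-v) ?_⟩
  simp only [Pt.coe_neg] at hv ⊢
  omega

/-- There is no position `0`, so `-1` and `1` are neighbours. -/
theorem covBy_cases {i k : Pt n} (h : i ⋖ k) :
    (i : ℤ) = -1 ∧ (k : ℤ) = 1 ∨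
      (k : ℤ) = i + 1 ∧ (0 < (i : ℤ) ∨ (k : ℤ) < 0) := by
  rw [covBy_iff] at h
  have hi := i.2
  have hk := k.2
  rw [abs_le] at hi hk
  have h1 := h.1
  by_cases h0 : (i : ℤ) + 1 = 0
  · by_contra hc
    refine h.2 ⟨1, one_ne_zero, ?_⟩ ⟨?_, ?_⟩
    · rw [abs_one]; omega
    · change (i : ℤ) < 1; omega
    · change (1 : ℤ) < k; omega
  · by_contra hc
    refine h.2 ⟨i + 1, h0, ?_⟩ ⟨?_, ?_⟩
    · rw [abs_le]; omega
    · change (i : ℤ) < i + 1; omega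
    · change (i : ℤ) + 1 < k; omega

theorem isSimple_refl {i k : Pt n} (h : i ⋖ k) : IsSimple (refl i k) := by
  have key : ∀ i k : Pt n, 0 < (i : ℤ) → (k : ℤ) = i + 1 → IsSimple (refl i k) := by
    intro i k hi hk
    exact Or.inr ⟨i, k, hi, hk, coe_refl i k (by rw [abs_of_pos hi, abs_of_pos] <;> omega)⟩
  rcases covBy_cases h with ⟨h1, h2⟩ | ⟨h1, h2 | h2⟩
  · have : i = -k := Pt.ext' (by rw [Pt.coe_neg]; omega)
    subst this
    left
    exact ⟨k, h2, by rw [refl_comm, coe_refl_self_neg]⟩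
  · exact key i k h2 h1
  · rw [← refl_neg_neg, refl_comm]
    exact key _ _ (by rw [Pt.coe_neg]; omega) (by simp only [Pt.coe_neg]; omega)

theorem IsSimple.eq_refl {s : SignedPerm n} (h : IsSimple s) :
    ∃ i k : Pt n, i ⋖ k ∧ s = refl i k := by
  rcases h with ⟨i, hi, h⟩ | ⟨i, k, hi, hk, h⟩
  · refine ⟨-i, i, ?_, ?_⟩
    · rw [covBy_iff]
      refine ⟨by rw [Pt.coe_neg]; omega, fun v hv => v.ne_zero ?_⟩
      rw [Pt.coe_neg] at hv
      omega
    · rw [refl_comm]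
      exact Subtype.ext (h.trans (coe_refl_self_neg i).symm)
  · refine ⟨i, k, ?_, ?_⟩
    · rw [covBy_iff]
      exact ⟨by omega, fun v hv => by omega⟩
    · exact Subtype.ext (h.trans (coe_refl i k (by rw [abs_of_pos hi, abs_of_pos] <;> omega)).symm)

theorem reflFun_lt_iff {i k : Pt n} (hik : i ⋖ k) {a b : Pt n} (hab : (a : ℤ) < b) :
    (reflFun i k b : ℤ) < reflFun i k a ↔ a = i ∧ b = k ∨ a = -k ∧ b = -i := by
  have h := covBy_cases hik
  clear hik
  have := i.ne_zero
  have := a.ne_zero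
  have := b.ne_zero
  simp only [reflFun, Pt.eq_iff, Pt.coe_neg]
  split_ifs <;> (try simp only [Pt.coe_neg]) <;> omega

/-- A simple reflection inverts only the pair that it exchanges. -/
theorem IsSimple.eq_refl_of_lt {s : SignedPerm n} (h : IsSimple s) {a b : Pt n}
    (hab : (a : ℤ) < b) (hs : (s.1 b : ℤ) < s.1 a) : s = refl a b := by
  obtain ⟨i, k, hik, rfl⟩ := h.eq_refl
  rcases (reflFun_lt_iff hik hab).mp hs with ⟨rfl, rfl⟩ | ⟨rfl, rfl⟩
  · rfl
  · rw [refl_neg_neg, refl_comm]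

/-- Induction on a bound `d` for the distance: any intermediate position splits the interval, and
one of the two halves still has its ends out of order. -/
theorem exists_descent (w : SignedPerm n) :
    ∀ (d : ℕ) (x y : Pt n), (x : ℤ) < y → (y - x : ℤ) ≤ d → (w.1 y : ℤ) < w.1 x →
      ∃ i k : Pt n, i ⋖ k ∧ (x : ℤ) ≤ i ∧ (k : ℤ) ≤ y ∧ (w.1 k : ℤ) < w.1 i := by
  intro d
  induction d with
  | zero => intro x y h1 h2; omega
  | succ d ih =>
    intro x y h1 h2 h3
    by_cases hc : x ⋖ y
    · exact ⟨x, y, hc, le_rfl, le_rfl, h3⟩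
    · rw [covBy_iff] at hc
      push Not at hc
      obtain ⟨z, hz1, hz2⟩ := hc h1
      by_cases hz : (w.1 z : ℤ) < w.1 x
      · obtain ⟨i, k, h4, h5, h6, h7⟩ := ih x z hz1 (by omega) hz
        exact ⟨i, k, h4, h5, by omega, h7⟩
      · obtain ⟨i, k, h4, h5, h6, h7⟩ := ih z y hz2 (by omega) (by omega)
        exact ⟨i, k, h4, by omega, h6, h7⟩

theorem lt_of_no_descent (w : SignedPerm n) {x y : Pt n} (hxy : (x : ℤ) < y)
    (h : ∀ i k : Pt n, i ⋖ k → (x : ℤ) ≤ i → (k : ℤ) ≤ y → ¬(w.1 k : ℤ) < w.1 i) :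
    (w.1 x : ℤ) < w.1 y := by
  by_contra hc
  have : (w.1 y : ℤ) ≠ w.1 x := fun e => by
    have := w.1.injective (Pt.ext' e)
    subst this
    omega
  obtain ⟨i, k, h1, h2, h3, h4⟩ :=
    exists_descent w (y - x : ℤ).toNat x y hxy (by omega) (by omega)
  exact h i k h1 h2 h3 h4

/-- Signed permutations that put all pairs of values in the same order are equal. -/
theorem eq_of_pos_lt_iff {u w : SignedPerm n}
    (h : ∀ a b, pos u a < pos u b ↔ pos w a < pos w b) : u = w := by
  have hs : ∀ x y : Pt n, x < y ↔ w.1.symm (u.1 x) < w.1.symm (u.1 y) := by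
    intro x y
    have := h (u.1 x) (u.1 y)
    rw [pos_apply, pos_apply] at this
    exact this
  let e : Pt n ≃o Pt n :=
    { toEquiv := u.1.trans w.1.symm
      map_rel_iff' := by
        intro x y
        rw [← not_lt, ← not_lt]
        exact not_congr (hs y x).symm }
  have he : e = OrderIso.refl (Pt n) := Subsingleton.elim _ _
  refine Subtype.ext (Equiv.ext fun x => ?_)
  have h1 : e x = x := by rw [he]; rfl
  exact ((Equiv.symm_apply_eq w.1).mp h1)

/-! ### Length and inversions -/

theorem pos_refl_mul (a b : Pt n) (w : SignedPerm n) (v : Pt n) :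
    pos (refl a b * w) v = pos w (reflFun a b v) := rfl

/-- The strong exchange condition. If the first letter `s` keeps `a`, `b` in order, induction
applies to `s a`, `s b`, and conjugation moves the reflection past `s`. If `s` inverts them, then
`s` is the reflection itself, and deleting it gives the shorter word. -/
theorem exchange (l : List (SignedPerm n)) (hl : ∀ s ∈ l, IsSimple s) :
    ∀ a b : Pt n, (a : ℤ) < b → pos l.prod b < pos l.prod a →
      ∃ l' : List (SignedPerm n), (∀ s ∈ l', IsSimple s) ∧ l'.prod = refl a b * l.prod ∧
        l'.length < l.length := by
  induction l with
  | nil =>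
    intro a b h1 h2
    change (b : ℤ) < a at h2
    omega
  | cons s l ih =>
    intro a b h1 h2
    have hs : IsSimple s := hl s (by simp)
    have hl' : ∀ s ∈ l, IsSimple s := fun s h => hl s (by simp [h])
    have hinv : s.1.symm = s.1 := by
      obtain ⟨i, k, -, rfl⟩ := hs.eq_refl
      rfl
    rw [List.prod_cons, pos_mul, pos_mul, hinv] at h2
    rcases lt_trichotomy (s.1 a : ℤ) (s.1 b) with h | h | h
    · obtain ⟨l', h3, h4, h5⟩ := ih hl' (s.1 a) (s.1 b) h h2
      refine ⟨s :: l', ?_, ?_, by simpa using h5⟩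
      · intro t ht
        rcases List.mem_cons.mp ht with rfl | ht
        · exact hs
        · exact h3 t ht
      · rw [List.prod_cons, h4, List.prod_cons, ← mul_assoc, mul_refl, ← mul_assoc]
        have hss : ∀ v, s.1 (s.1 v) = v := fun v => by
          conv_lhs => rw [← hinv]
          rw [hinv]
          nth_rewrite 1 [← hinv]
          exact s.1.symm_apply_apply v
        rw [hss, hss]
    · have := s.1.injective (Pt.ext' h)
      subst this
      omega
    · have := hs.eq_refl_of_lt h1 h
      subst this
      refine ⟨l, hl', ?_, by simp⟩
      rw [List.prod_cons, ← mul_assoc, refl_mul_self, one_mul]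

/-- The pairs `a < b` of values such that `b` precedes `a`. -/
def invPairs (w : SignedPerm n) : Set (Pt n × Pt n) :=
  {x | (x.1 : ℤ) < x.2 ∧ pos w x.2 < pos w x.1}

/-- Values `a < b` in adjacent positions, with `b` first, can be exchanged; this removes the
inversion of `a` and `b` and no other. -/
theorem pos_refl_mul_lt_iff {w : SignedPerm n} {a b : Pt n} (hab : (a : ℤ) < b)
    (h : pos w b < pos w a) (hadj : ∀ v, ¬(pos w b < pos w v ∧ pos w v < pos w a))
    {x y : Pt n} (hxy : (x : ℤ) < y) :
    pos (refl a b * w) y < pos (refl a b * w) x ↔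
      pos w y < pos w x ∧ ¬(x = a ∧ y = b) ∧ ¬(x = -b ∧ y = -a) := by
  have hik : w.1.symm b ⋖ w.1.symm a := by
    refine covBy_iff.mpr ⟨h, fun v hv => hadj (w.1 v) ?_⟩
    rw [pos_apply]
    exact hv
  have hsymm : ∀ v, w.1.symm (-v) = -w.1.symm v := (w⁻¹).2
  have e1 : refl a b * w = w * refl (w.1.symm b) (w.1.symm a) := by
    rw [mul_refl, Equiv.apply_symm_apply, Equiv.apply_symm_apply, refl_comm]
  have e2 : ∀ v, pos (refl a b * w) v = reflFun (w.1.symm b) (w.1.symm a) (w.1.symm v) :=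
    fun v => by rw [e1]; rfl
  rw [e2, e2]
  rcases lt_trichotomy (pos w x) (pos w y) with h1 | h1 | h1
  · rw [reflFun_lt_iff hik h1]
    simp only [← hsymm, EmbeddingLike.apply_eq_iff_eq]
    refine ⟨?_, fun h2 => absurd h2.1 (by omega)⟩
    rintro (⟨rfl, rfl⟩ | ⟨rfl, rfl⟩)
    · omega
    · simp only [Pt.coe_neg] at hxy
      omega
  · rw [pos_inj w h1] at hxy
    omega
  · have h2 := reflFun_lt_iff hik h1
    simp only [← hsymm, EmbeddingLike.apply_eq_iff_eq] at h2
    have h3 : (reflFun (w.1.symm b) (w.1.symm a) (w.1.symm x) : ℤ) ≠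
        reflFun (w.1.symm b) (w.1.symm a) (w.1.symm y) := fun e => by
      have := w.1.symm.injective ((reflFun_involutive _ _).injective (Pt.ext' e))
      rw [this] at hxy
      omega
    constructor
    · intro h4
      refine ⟨h1, ?_, ?_⟩
      · rintro ⟨rfl, rfl⟩
        have := h2.mpr (Or.inl ⟨rfl, rfl⟩)
        omega
      · rintro ⟨rfl, rfl⟩
        have := h2.mpr (Or.inr ⟨rfl, rfl⟩)
        omega
    · rintro ⟨-, h4, h5⟩
      by_contra h6
      rcases h2.mp (by omega) with h7 | h7
      · exact h4 ⟨h7.2, h7.1⟩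
      · exact h5 ⟨h7.2, h7.1⟩

/-- Removing a descent is right multiplication by a simple reflection and lowers the number of
inverted pairs. An element without descents is the identity. -/
theorem exists_word (w : SignedPerm n) :
    ∃ l : List (SignedPerm n), (∀ s ∈ l, IsSimple s) ∧ l.prod = w := by
  induction hk : (invPairs w).ncard using Nat.strong_induction_on generalizing w with
  | _ k ih =>
    by_cases hd : ∃ i k : Pt n, i ⋖ k ∧ (w.1 k : ℤ) < w.1 i
    · obtain ⟨i, k, hik, hlt⟩ := hd
      have hs := isSimple_refl hik
      have hadj : ∀ v, ¬(pos w (w.1 i) < pos w v ∧ pos w v < pos w (w.1 k)) := by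
        intro v
        rw [pos_apply, pos_apply]
        exact (covBy_iff.mp hik).2 _
      have key := fun x y => pos_refl_mul_lt_iff (w := w) hlt
        (by rw [pos_apply, pos_apply]; exact hik.1) hadj (x := x) (y := y)
      have hss : invPairs (refl (w.1 k) (w.1 i) * w) ⊂ invPairs w := by
        rw [Set.ssubset_iff_of_subset]
        · refine ⟨(w.1 k, w.1 i), ⟨hlt, by rw [pos_apply, pos_apply]; exact hik.1⟩, fun hc => ?_⟩
          exact ((key _ _ hlt).mp hc.2).2.1 ⟨rfl, rfl⟩
        · intro x hx
          exact ⟨hx.1, ((key _ _ hx.1).mp hx.2).1⟩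
      obtain ⟨l, hl, hp⟩ := ih _ (hk ▸ Set.ncard_lt_ncard hss (Set.toFinite _)) _ rfl
      rw [refl_comm, ← mul_refl] at hp
      refine ⟨l ++ [refl i k], ?_, ?_⟩
      · intro s h
        rcases List.mem_append.mp h with h | h
        · exact hl s h
        · rw [List.mem_singleton.mp h]; exact hs
      · rw [List.prod_append, hp, List.prod_singleton, mul_assoc, refl_mul_self, mul_one]
    · push Not at hd
      refine ⟨[], by simp, ?_⟩
      have hm : ∀ x y : Pt n, (x : ℤ) < y → (w.1 x : ℤ) < w.1 y := fun x y hxy =>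
        lt_of_no_descent w hxy fun i k h _ _ => not_lt.mpr (hd i k h)
      refine eq_of_pos_lt_iff fun a b => ?_
      rw [List.prod_nil]
      change (a : ℤ) < b ↔ _
      have h1 := hm (w.1.symm a) (w.1.symm b)
      have h2 := hm (w.1.symm b) (w.1.symm a)
      simp only [Equiv.apply_symm_apply] at h1 h2
      refine ⟨fun h => ?_, h1⟩
      by_contra hc
      rcases lt_or_eq_of_le (not_lt.mp hc) with h3 | h3
      · have := h2 h3; omega
      · rw [pos_inj w h3] at h; omega

theorem length_le (l : List (SignedPerm n)) (hl : ∀ s ∈ l, IsSimple s) :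
    length l.prod ≤ l.length := Nat.sInf_le ⟨l, hl, rfl, rfl⟩

theorem exists_reduced (w : SignedPerm n) :
    ∃ l : List (SignedPerm n), (∀ s ∈ l, IsSimple s) ∧ l.prod = w ∧ l.length = length w := by
  obtain ⟨l, hl, hw⟩ := exists_word w
  have h : {k | ∃ l : List (SignedPerm n), (∀ s ∈ l, IsSimple s) ∧ l.prod = w ∧
      l.length = k}.Nonempty := ⟨_, l, hl, hw, rfl⟩
  exact Nat.sInf_mem h

theorem length_refl_mul_lt {w : SignedPerm n} {a b : Pt n} (hab : (a : ℤ) < b)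
    (h : pos w b < pos w a) : length (refl a b * w) < length w := by
  obtain ⟨l, hl, rfl, hw⟩ := exists_reduced w
  obtain ⟨l', h1, h2, h3⟩ := exchange l hl a b hab h
  have := length_le l' h1
  rw [h2] at this
  omega

/-- The bridge from Coxeter length to one-line notation. Exactly one of `w` and `t w` has the pair
inverted, and by the exchange condition that one is longer. -/
theorem refl_mem_inversions_iff {w : SignedPerm n} {a b : Pt n} (hab : (a : ℤ) < b) :
    refl a b ∈ inversions w ↔ pos w b < pos w a := by
  constructor
  · rintro ⟨-, h⟩
    by_contra hc
    have h1 : pos w a < pos w b := lt_of_le_of_ne (not_lt.mp hc) fun e => by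
      rw [pos_inj w e] at hab; omega
    have h2 : pos (refl a b * w) b < pos (refl a b * w) a := by
      have e1 : reflFun a b b = a := by
        simp only [reflFun]; split_ifs with h3
        · exact h3
        · rfl
      have e2 : reflFun a b a = b := by simp [reflFun]
      rw [pos_refl_mul, pos_refl_mul, e1, e2]; exact h1
    have h3 := length_refl_mul_lt hab h2
    rw [← mul_assoc, refl_mul_self, one_mul] at h3
    omega
  · exact fun h => ⟨(isReflection_iff _).mpr ⟨a, b, hab, rfl⟩, length_refl_mul_lt hab h⟩

/-! ### The weak order -/

theorem weak_le_iff {u w : SignedPerm n} :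
    u ≤ w ↔ ∀ a b : Pt n, (a : ℤ) < b → pos u b < pos u a → pos w b < pos w a := by
  constructor
  · intro h a b hab hu
    exact (refl_mem_inversions_iff hab).mp (h ((refl_mem_inversions_iff hab).mpr hu))
  · intro h t ht
    obtain ⟨a, b, hab, rfl⟩ := (isReflection_iff t).mp ht.1
    exact (refl_mem_inversions_iff hab).mpr (h a b hab ((refl_mem_inversions_iff hab).mp ht))

theorem weak_antisymm {u w : SignedPerm n} (h1 : u ≤ w) (h2 : w ≤ u) : u = w := by
  rw [weak_le_iff] at h1 h2
  have key : ∀ a b : Pt n, (a : ℤ) < b → (pos u b < pos u a ↔ pos w b < pos w a) :=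
    fun a b hab => ⟨h1 a b hab, h2 a b hab⟩
  refine eq_of_pos_lt_iff fun a b => ?_
  rcases lt_trichotomy (a : ℤ) b with h | h | h
  · have h3 := key a b h
    have h4 : pos u a ≠ pos u b := fun e => by rw [pos_inj u e] at h; omega
    have h5 : pos w a ≠ pos w b := fun e => by rw [pos_inj w e] at h; omega
    omega
  · rw [Pt.ext' h]; simp
  · exact key b a h

/-! ### Signed permutations from symmetric linear orders; joins and meets -/

/-- A linear order on the values that is reversed by negation is the order of the values in the
long one-line notation of a signed permutation. -/
theorem exists_of_order (r : Pt n → Pt n → Prop) (hirr : ∀ x, ¬r x x)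
    (htr : ∀ x y z, r x y → r y z → r x z) (htot : ∀ x y, x ≠ y → r x y ∨ r y x)
    (hneg : ∀ x y, r x y → r (-y) (-x)) :
    ∃ w : SignedPerm n, ∀ x y, pos w x < pos w y ↔ r x y := by
  classical
  have : Fintype (Pt n) := Fintype.ofFinite _
  have hsto : IsStrictTotalOrder (Pt n) r :=
    { irrefl := hirr
      trans := htr
      trichotomous := fun x y h1 h2 => by
        by_contra h
        rcases htot x y h with h | h
        · exact h1 h
        · exact h2 h }
  let e₁ : Fin (Fintype.card (Pt n)) ≃o Pt n := monoEquivOfFin (Pt n) rfl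
  let e₂ : Fin (Fintype.card (Pt n)) ≃ Pt n :=
    (@monoEquivOfFin (Pt n) _ (linearOrderOfSTO r) _ rfl).toEquiv
  have h₂ : ∀ a b, r (e₂ a) (e₂ b) ↔ a < b := fun a b =>
    @OrderIso.lt_iff_lt _ _ _ (linearOrderOfSTO r).toPreorder
      (@monoEquivOfFin (Pt n) _ (linearOrderOfSTO r) _ rfl) a b
  let e : Equiv.Perm (Pt n) := e₁.symm.toEquiv.trans e₂
  have he : ∀ x y, r (e x) (e y) ↔ (x : ℤ) < y := fun x y => by
    change r (e₂ (e₁.symm x)) (e₂ (e₁.symm y)) ↔ x < y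
    rw [h₂, OrderIso.lt_iff_lt]
  have hasymm : ∀ x y, r x y → ¬r y x := fun x y h1 h2 => hirr x (htr _ _ _ h1 h2)
  have hnegiff : ∀ x y, r (-y) (-x) ↔ r x y := fun x y => by
    refine ⟨fun h => ?_, hneg x y⟩
    have := hneg _ _ h
    rwa [Pt.neg_neg, Pt.neg_neg] at this
  -- Conjugation by negation reverses both the natural order and `r`. So `x ↦ e⁻¹ (-e (-x))` is an
  -- automorphism of a finite chain, hence the identity, and `e` is odd.
  have hs : ∀ x y : Pt n, x < y ↔ e.symm (-e (-x)) < e.symm (-e (-y)) := by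
    intro x y
    have h1 := he (e.symm (-e (-x))) (e.symm (-e (-y)))
    rw [Equiv.apply_symm_apply, Equiv.apply_symm_apply, hnegiff, he] at h1
    simp only [Pt.coe_neg] at h1
    rw [Pt.lt_iff, Pt.lt_iff, ← h1]
    omega
  let ν : Equiv.Perm (Pt n) := ⟨fun x => -x, fun x => -x, Pt.neg_neg, Pt.neg_neg⟩
  let f : Pt n ≃o Pt n :=
    { toEquiv := ν.trans (e.trans (ν.trans e.symm))
      map_rel_iff' := by
        intro x y
        rw [← not_lt, ← not_lt]
        exact not_congr (hs y x).symm }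
  have hf : f = OrderIso.refl (Pt n) := Subsingleton.elim _ _
  have hodd : ∀ x, e (-x) = -e x := fun x => by
    have h1 : f x = x := by rw [hf]; rfl
    have h2 : -e (-x) = e x := (Equiv.symm_apply_eq e).mp h1
    rw [← h2, Pt.neg_neg]
  refine ⟨⟨e, hodd⟩, fun x y => ?_⟩
  have := he (e.symm x) (e.symm y)
  rw [Equiv.apply_symm_apply, Equiv.apply_symm_apply] at this
  exact this.symm

theorem exists_of_key (f : Pt n → ℤ) (hneg : ∀ x, f (-x) = -f x) (hinj : Function.Injective f) :
    ∃ w : SignedPerm n, ∀ x y, pos w x < pos w y ↔ f x < f y :=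
  exists_of_order (fun x y => f x < f y) (fun _ => lt_irrefl _) (fun _ _ _ => lt_trans)
    (fun _ _ h => lt_or_gt_of_ne fun e => h (hinj e))
    (fun x y h => by rw [hneg, hneg]; omega)

section Join

/-- `u` is larger than `v` and precedes it in `x` or in `y`. -/
def JoinStep (x y : SignedPerm n) (u v : Pt n) : Prop :=
  (v : ℤ) < u ∧ (pos x u < pos x v ∨ pos y u < pos y v)

variable {x y : SignedPerm n}

theorem JoinStep.neg {u v : Pt n} (h : JoinStep x y u v) : JoinStep x y (-v) (-u) := by
  have h1 := h.1
  have h2 := h.2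
  refine ⟨by simp only [Pt.coe_neg]; omega, ?_⟩
  simp only [pos_neg]
  omega

theorem joinTrans_lt {u v : Pt n} (h : Relation.TransGen (JoinStep x y) u v) : (v : ℤ) < u := by
  induction h with
  | single h => exact h.1
  | tail _ h ih => exact h.1.trans ih

theorem joinTrans_neg {u v : Pt n} (h : Relation.TransGen (JoinStep x y) u v) :
    Relation.TransGen (JoinStep x y) (-v) (-u) := by
  induction h with
  | single h => exact .single h.neg
  | tail _ h ih => exact .head h.neg ih

theorem JoinStep.split {u v : Pt n} (h : JoinStep x y u v) {z : Pt n} (h1 : (v : ℤ) < z)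
    (h2 : (z : ℤ) < u) : JoinStep x y u z ∨ JoinStep x y z v := by
  have := h.2
  unfold JoinStep
  omega

/-- This makes the complement of the closure transitive as well, which a set of pairs needs in order
to be the inversions of a linear order. The value `z` either occurs in the chain from `u` to `v` or
falls strictly inside one of its steps, where it forms a step with one of the ends. -/
theorem joinTrans_split {u v : Pt n} (h : Relation.TransGen (JoinStep x y) u v) :
    ∀ z : Pt n, (v : ℤ) < z → (z : ℤ) < u →
      Relation.TransGen (JoinStep x y) u z ∨ Relation.TransGen (JoinStep x y) z v := by
  induction h with
  | single h =>
    intro z h1 h2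
    exact (h.split h1 h2).imp .single .single
  | @tail c d hc hd ih =>
    intro z h1 h2
    rcases lt_trichotomy (c : ℤ) z with h3 | h3 | h3
    · exact (ih z h3 h2).imp id fun h => .tail h hd
    · rw [← Pt.ext' h3]
      exact Or.inl hc
    · exact (hd.split h1 h3).imp (fun h => .tail hc h) .single

/-- The inverted pairs of the join form the transitive closure of the union of those of `x` and `y`.
An upper bound inverts the union and, precedence being transitive, also the closure. -/
theorem exists_isLUB (x y : SignedPerm n) : ∃ z, IsLUB {x, y} z := by
  let T := Relation.TransGen (JoinStep x y)
  obtain ⟨z, hz⟩ := exists_of_order (fun u v => T u v ∨ (u : ℤ) < v ∧ ¬T v u)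
    (fun u h => by
      rcases h with h | h
      · have := joinTrans_lt h; omega
      · omega)
    (fun u v w huv hvw => by
      rcases huv with h1 | ⟨h1, h1'⟩ <;> rcases hvw with h2 | ⟨h2, h2'⟩
      · exact Or.inl (h1.trans h2)
      · have h3 := joinTrans_lt h1
        rcases lt_trichotomy (u : ℤ) w with h4 | h4 | h4
        · exact Or.inr ⟨h4, fun h5 => h2' (h5.trans h1)⟩
        · rw [Pt.ext' h4] at h1
          exact absurd h1 h2'
        · exact Or.inl ((joinTrans_split h1 w h2 h4).resolve_right h2')
      · have h3 := joinTrans_lt h2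
        rcases lt_trichotomy (u : ℤ) w with h4 | h4 | h4
        · exact Or.inr ⟨h4, fun h5 => h1' (h2.trans h5)⟩
        · rw [← Pt.ext' h4] at h2
          exact absurd h2 h1'
        · exact Or.inl ((joinTrans_split h2 u h4 h1).resolve_left h1')
      · refine Or.inr ⟨by omega, fun h5 => ?_⟩
        rcases joinTrans_split h5 v h1 h2 with h6 | h6
        · exact h2' h6
        · exact h1' h6)
    (fun u v huv => by
      by_cases h : T u v
      · exact Or.inl (Or.inl h)
      · by_cases h' : T v u
        · exact Or.inr (Or.inl h')
        · have : (u : ℤ) ≠ v := fun e => huv (Pt.ext' e)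
          rcases lt_or_gt_of_ne this with h1 | h1
          · exact Or.inl (Or.inr ⟨h1, h'⟩)
          · exact Or.inr (Or.inr ⟨h1, h⟩))
    (fun u v h => by
      refine h.imp joinTrans_neg fun h => ⟨by simp only [Pt.coe_neg]; omega, fun h5 => h.2 ?_⟩
      have := joinTrans_neg h5
      rwa [Pt.neg_neg, Pt.neg_neg] at this)
  have hz' : ∀ a b : Pt n, (a : ℤ) < b → (pos z b < pos z a ↔ T b a) := fun a b hab => by
    rw [hz]
    exact ⟨fun h => h.resolve_right fun h => by omega, Or.inl⟩
  refine ⟨z, ?_, ?_⟩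
  · rintro w (rfl | rfl) <;> rw [weak_le_iff] <;> intro a b hab hw <;> rw [hz' a b hab]
    · exact .single ⟨hab, Or.inl hw⟩
    · exact .single ⟨hab, Or.inr hw⟩
  · intro w hw
    have hx := weak_le_iff.mp (hw (Set.mem_insert x {y}))
    have hy := weak_le_iff.mp (hw (Set.mem_insert_of_mem x rfl))
    rw [weak_le_iff]
    intro a b hab h
    rw [hz' a b hab] at h
    have hstep : ∀ u v, JoinStep x y u v → pos w u < pos w v := fun u v h =>
      h.2.elim (hx v u h.1) (hy v u h.1)
    clear hab
    induction h with
    | single h => exact hstep _ _ h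
    | tail _ h ih => exact ih.trans (hstep _ _ h)

end Join

/-! ### The antiautomorphism `w ↦ w₀ w` -/

/-- The longest element `-1`. -/
def longest (n : ℕ) : SignedPerm n :=
  ⟨⟨fun x => -x, fun x => -x, Pt.neg_neg, Pt.neg_neg⟩, fun _ => rfl⟩

theorem pos_longest_mul (w : SignedPerm n) (v : Pt n) : pos (longest n * w) v = -pos w v := by
  rw [pos_mul]
  exact pos_neg w v

theorem longest_mul_longest_mul (w : SignedPerm n) : longest n * (longest n * w) = w :=
  eq_of_pos_lt_iff fun a b => by simp only [pos_longest_mul, _root_.neg_neg]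

theorem pos_lt_of_not_lt {w : SignedPerm n} {a b : Pt n} (hab : (a : ℤ) ≠ b)
    (h : ¬pos w a < pos w b) : pos w b < pos w a :=
  lt_of_le_of_ne (not_lt.mp h) fun e => hab (by rw [pos_inj w e])

theorem longest_mul_le_longest_mul {u w : SignedPerm n} :
    longest n * u ≤ longest n * w ↔ w ≤ u := by
  simp only [weak_le_iff, pos_longest_mul]
  constructor
  · intro h a b hab h1
    by_contra h2
    have := h a b hab (by have := pos_lt_of_not_lt (by omega) h2; omega)
    omega
  · intro h a b hab h1
    by_contra h2
    have := h a b hab (pos_lt_of_not_lt (by omega) (by omega))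
    omega

theorem longest_mul_le {u w : SignedPerm n} : longest n * u ≤ w ↔ longest n * w ≤ u := by
  rw [← longest_mul_le_longest_mul, longest_mul_longest_mul]

theorem le_longest_mul {u w : SignedPerm n} : u ≤ longest n * w ↔ w ≤ longest n * u := by
  rw [← longest_mul_le_longest_mul, longest_mul_longest_mul]

theorem isLUB_longest_mul {x y m : SignedPerm n} (h : IsGLB {x, y} m) :
    IsLUB {longest n * x, longest n * y} (longest n * m) := by
  refine ⟨?_, fun z hz => ?_⟩
  · rintro w (rfl | rfl) <;> rw [longest_mul_le_longest_mul]
    · exact h.1 (Set.mem_insert x {y})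
    · exact h.1 (Set.mem_insert_of_mem x rfl)
  · rw [longest_mul_le]
    refine h.2 ?_
    rintro w (rfl | rfl) <;> rw [longest_mul_le]
    · exact hz (Set.mem_insert _ _)
    · exact hz (Set.mem_insert_of_mem _ rfl)

theorem isGLB_longest_mul {x y m : SignedPerm n} (h : IsLUB {x, y} m) :
    IsGLB {longest n * x, longest n * y} (longest n * m) := by
  refine ⟨?_, fun z hz => ?_⟩
  · rintro w (rfl | rfl) <;> rw [longest_mul_le_longest_mul]
    · exact h.1 (Set.mem_insert x {y})
    · exact h.1 (Set.mem_insert_of_mem x rfl)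
  · rw [le_longest_mul]
    refine h.2 ?_
    rintro w (rfl | rfl) <;> rw [le_longest_mul]
    · exact hz (Set.mem_insert _ _)
    · exact hz (Set.mem_insert_of_mem _ rfl)

theorem exists_isGLB (x y : SignedPerm n) : ∃ z, IsGLB {x, y} z := by
  obtain ⟨z, hz⟩ := exists_isLUB (longest n * x) (longest n * y)
  have := isGLB_longest_mul hz
  rw [longest_mul_longest_mul, longest_mul_longest_mul] at this
  exact ⟨_, this⟩

namespace Arc

/-! ### Endpoints together with left or right points -/

/-- `v` is the bottom endpoint or a right point. -/
def BotRight (α : Arc n) (v : Pt n) : Prop := v = α.bot ∨ v ∈ α.right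

/-- `v` is the top endpoint or a left point. -/
def TopLeft (α : Arc n) (v : Pt n) : Prop := v = α.top ∨ v ∈ α.left

/-- `v` is the bottom endpoint or a left point. -/
def BotLeft (α : Arc n) (v : Pt n) : Prop := v = α.bot ∨ v ∈ α.left

/-- `v` is the top endpoint or a right point. -/
def TopRight (α : Arc n) (v : Pt n) : Prop := v = α.top ∨ v ∈ α.right

variable (α : Arc n)

theorem bot_lt : (α.bot : ℤ) < α.top := α.bot_lt_top

variable {α}

theorem right_bounds {v : Pt n} (h : v ∈ α.right) : (α.bot : ℤ) < v ∧ (v : ℤ) < α.top :=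
  α.right_subset h

theorem mem_left {v : Pt n} :
    v ∈ α.left ↔ ((α.bot : ℤ) < v ∧ (v : ℤ) < α.top) ∧ v ∉ α.right := Iff.rfl

theorem left_bounds {v : Pt n} (h : v ∈ α.left) : (α.bot : ℤ) < v ∧ (v : ℤ) < α.top := h.1

theorem BotRight.bounds {v : Pt n} (h : α.BotRight v) : (α.bot : ℤ) ≤ v ∧ (v : ℤ) < α.top := by
  have := α.bot_lt
  rcases h with rfl | h
  · omega
  · have := right_bounds h; omega

theorem BotLeft.bounds {v : Pt n} (h : α.BotLeft v) : (α.bot : ℤ) ≤ v ∧ (v : ℤ) < α.top := by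
  have := α.bot_lt
  rcases h with rfl | h
  · omega
  · have := left_bounds h; omega

theorem TopRight.bounds {v : Pt n} (h : α.TopRight v) : (α.bot : ℤ) < v ∧ (v : ℤ) ≤ α.top := by
  have := α.bot_lt
  rcases h with rfl | h
  · omega
  · have := right_bounds h; omega

theorem TopLeft.bounds {v : Pt n} (h : α.TopLeft v) : (α.bot : ℤ) < v ∧ (v : ℤ) ≤ α.top := by
  have := α.bot_lt
  rcases h with rfl | h
  · omega
  · have := left_bounds h; omega

theorem bot_notMem : α.bot ∉ α.right := fun h => by have := right_bounds h; omega

theorem top_notMem : α.top ∉ α.right := fun h => by have := right_bounds h; omega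

theorem botRight_bot : α.BotRight α.bot := Or.inl rfl

theorem botLeft_bot : α.BotLeft α.bot := Or.inl rfl

theorem topRight_top : α.TopRight α.top := Or.inl rfl

theorem topLeft_top : α.TopLeft α.top := Or.inl rfl

theorem topLeft_iff {v : Pt n} :
    α.TopLeft v ↔ (α.bot : ℤ) < v ∧ (v : ℤ) ≤ α.top ∧ v ∉ α.right := by
  constructor
  · intro h
    refine ⟨h.bounds.1, h.bounds.2, ?_⟩
    rcases h with rfl | h
    · exact top_notMem
    · exact h.2
  · rintro ⟨h1, h2, h3⟩
    rcases lt_or_eq_of_le h2 with h2 | h2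
    · exact Or.inr ⟨⟨h1, h2⟩, h3⟩
    · exact Or.inl (Pt.ext' h2)

theorem botLeft_iff {v : Pt n} :
    α.BotLeft v ↔ (α.bot : ℤ) ≤ v ∧ (v : ℤ) < α.top ∧ v ∉ α.right := by
  constructor
  · intro h
    refine ⟨h.bounds.1, h.bounds.2, ?_⟩
    rcases h with rfl | h
    · exact bot_notMem
    · exact h.2
  · rintro ⟨h1, h2, h3⟩
    rcases lt_or_eq_of_le h1 with h1 | h1
    · exact Or.inr ⟨⟨h1, h2⟩, h3⟩
    · exact Or.inl (Pt.ext' h1.symm)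

theorem topLeft_of_not_botRight {v : Pt n} (h1 : (α.bot : ℤ) ≤ v) (h2 : (v : ℤ) ≤ α.top)
    (h3 : ¬α.BotRight v) : α.TopLeft v := by
  refine topLeft_iff.mpr ⟨lt_of_le_of_ne h1 fun e => h3 (Or.inl (Pt.ext' e.symm)), h2, ?_⟩
  exact fun h => h3 (Or.inr h)

theorem TopLeft.not_botRight {v : Pt n} (h : α.TopLeft v) : ¬α.BotRight v := by
  rw [topLeft_iff] at h
  rintro (rfl | h')
  · omega
  · exact h.2.2 h'

/-! ### Negation and reversal of arcs -/

theorem neg_bot : (-α).bot = -α.top := rfl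

theorem neg_top : (-α).top = -α.bot := rfl

theorem mem_neg_right {v : Pt n} : v ∈ (-α).right ↔ -v ∈ α.left := Iff.rfl

theorem mem_neg_left {v : Pt n} : v ∈ (-α).left ↔ -v ∈ α.right := by
  rw [mem_left, mem_neg_right, mem_left, neg_bot, neg_top]
  simp only [Pt.coe_neg]
  refine ⟨fun h => ?_, fun h => ?_⟩
  · by_contra hc
    exact h.2 ⟨⟨by omega, by omega⟩, hc⟩
  · have := right_bounds h
    rw [Pt.coe_neg] at this
    exact ⟨⟨by omega, by omega⟩, fun h' => h'.2 h⟩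

theorem neg_eq_comm {a b : Pt n} : a = -b ↔ -a = b := by
  simp only [Pt.eq_iff, Pt.coe_neg]; omega

theorem neg_neg' : - -α = α := by
  refine Arc.ext (Pt.neg_neg _) (Pt.neg_neg _) (Set.ext fun v => ?_)
  rw [mem_neg_right, mem_neg_left, Pt.neg_neg]

theorem botRight_neg {v : Pt n} : (-α).BotRight v ↔ α.TopLeft (-v) := by
  unfold BotRight TopLeft
  rw [neg_bot, mem_neg_right, neg_eq_comm]

theorem topLeft_neg {v : Pt n} : (-α).TopLeft v ↔ α.BotRight (-v) := by
  unfold BotRight TopLeft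
  rw [neg_top, mem_neg_left, neg_eq_comm]

/-- The image of an arc under the reflection of the plane that sends `i` to `-i` and preserves
left and right. -/
def rev (α : Arc n) : Arc n where
  bot := -α.top
  top := -α.bot
  bot_lt_top := Pt.neg_lt_neg α.bot_lt_top
  right := {v | -v ∈ α.right}
  right_subset := fun v hv => by
    have := right_bounds hv
    rw [Pt.coe_neg] at this
    exact ⟨by rw [Pt.lt_iff, Pt.coe_neg]; omega, by rw [Pt.lt_iff, Pt.coe_neg]; omega⟩

theorem rev_bot : α.rev.bot = -α.top := rfl

theorem rev_top : α.rev.top = -α.bot := rfl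

theorem mem_rev_right {v : Pt n} : v ∈ α.rev.right ↔ -v ∈ α.right := Iff.rfl

theorem mem_rev_left {v : Pt n} : v ∈ α.rev.left ↔ -v ∈ α.left := by
  rw [mem_left, mem_left, mem_rev_right, rev_bot, rev_top]
  simp only [Pt.coe_neg]
  exact and_congr_left fun _ => by omega

theorem rev_rev : α.rev.rev = α := by
  refine Arc.ext (Pt.neg_neg _) (Pt.neg_neg _) (Set.ext fun v => ?_)
  rw [mem_rev_right, mem_rev_right, Pt.neg_neg]

theorem neg_rev : (-α).rev = -α.rev := by
  refine Arc.ext rfl rfl (Set.ext fun v => ?_)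
  rw [mem_rev_right, mem_neg_right, mem_neg_right, mem_rev_left]

theorem topRight_rev {v : Pt n} : α.rev.TopRight v ↔ α.BotRight (-v) := by
  unfold BotRight TopRight
  rw [rev_top, mem_rev_right, neg_eq_comm]

theorem botLeft_rev {v : Pt n} : α.rev.BotLeft v ↔ α.TopLeft (-v) := by
  unfold BotLeft TopLeft
  rw [rev_bot, mem_rev_left, neg_eq_comm]

/-! ### Arcs below a signed permutation -/

/-- Every pair that has to be inverted in a signed permutation with a descent along `α` is
inverted in `w`. -/
def Below (α : Arc n) (w : SignedPerm n) : Prop :=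
  ∀ a b, α.BotRight a → α.TopLeft b → (a : ℤ) < b → pos w b < pos w a

/-- No pair that has to be non-inverted in a signed permutation with an ascent along `α` is
inverted in `w`. -/
def Above (α : Arc n) (w : SignedPerm n) : Prop :=
  ∀ a b, α.BotLeft a → α.TopRight b → (a : ℤ) < b → pos w a < pos w b

theorem below_neg {w : SignedPerm n} : (-α).Below w ↔ α.Below w := by
  unfold Below
  simp only [botRight_neg, topLeft_neg]
  constructor
  · intro h a b ha hb hab
    have := h (-b) (-a) (by rwa [Pt.neg_neg]) (by rwa [Pt.neg_neg])
      (by simp only [Pt.coe_neg]; omega)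
    simp only [pos_neg] at this
    omega
  · intro h a b ha hb hab
    have := h (-b) (-a) hb ha (by simp only [Pt.coe_neg]; omega)
    simp only [pos_neg] at this
    omega

theorem above_rev {w : SignedPerm n} : α.rev.Above (longest n * w) ↔ α.Below w := by
  unfold Below Above
  simp only [botLeft_rev, topRight_rev, pos_longest_mul]
  constructor
  · intro h a b ha hb hab
    have := h (-b) (-a) (by rwa [Pt.neg_neg]) (by rwa [Pt.neg_neg])
      (by simp only [Pt.coe_neg]; omega)
    simp only [pos_neg] at this
    omega
  · intro h a b ha hb hab
    have := h (-b) (-a) hb ha (by simp only [Pt.coe_neg]; omega)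
    simp only [pos_neg] at this
    omega

theorem below_rev {w : SignedPerm n} : α.rev.Below (longest n * w) ↔ α.Above w := by
  rw [← above_rev, rev_rev, longest_mul_longest_mul]

theorem above_neg {w : SignedPerm n} : (-α).Above w ↔ α.Above w := by
  rw [← below_rev, ← below_rev, neg_rev, below_neg]

theorem Below.mono {u w : SignedPerm n} (huw : u ≤ w) (h : α.Below u) : α.Below w :=
  fun a b ha hb hab => weak_le_iff.mp huw a b hab (h a b ha hb hab)

/-! ### Arcs that represent join-irreducible elements -/

/-- The arcs that are symmetric, or are the upper arc of a non-overlapping symmetric pair, or are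
the right arc of an overlapping symmetric pair. -/
structure Adm (α : Arc n) : Prop where
  top_pos : 0 < (α.top : ℤ)
  neg_right : ∀ v ∈ α.right, -v ∉ α.right
  neg_bot : -α.bot ∉ α.right
  neg_top : -α.top ∉ α.right
  symm : (α.bot : ℤ) = -α.top →
    ∀ v : Pt n, (α.bot : ℤ) < v → (v : ℤ) < α.top → v ∈ α.right ∨ -v ∈ α.right

/-- The values in the last increasing block of the join-irreducible element of `α`. -/
def Last (α : Arc n) (v : Pt n) : Prop :=
  α.BotRight v ∨ (α.top : ℤ) < v ∧ ¬α.BotRight (-v)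

open Classical in
/-- The block of the value `v` in the join-irreducible element of `α`: `-1`, `0` or `1`. -/
noncomputable def block (α : Arc n) (v : Pt n) : ℤ :=
  if α.Last v then 1 else if α.Last (-v) then -1 else 0

theorem Adm.neg_botRight (h : α.Adm) {v : Pt n} (hv : α.BotRight v) : ¬α.BotRight (-v) := by
  rintro (h1 | h1)
  · rcases hv with rfl | hv
    · rw [Pt.eq_iff, Pt.coe_neg] at h1
      have := α.bot.ne_zero
      omega
    · have := h.neg_bot
      rw [← h1, Pt.neg_neg] at this
      exact this hv
  · rcases hv with rfl | hv
    · exact h.neg_bot h1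
    · exact h.neg_right v hv h1

theorem Adm.neg_last (h : α.Adm) {v : Pt n} (hv : α.Last v) : ¬α.Last (-v) := by
  have := h.top_pos
  unfold Last at *
  rw [Pt.neg_neg, Pt.coe_neg]
  rintro (h1 | ⟨h1, h2⟩)
  · rcases hv with hv | hv
    · exact h.neg_botRight hv h1
    · exact hv.2 h1
  · rcases hv with hv | hv
    · exact h2 hv
    · omega

theorem block_eq_one {v : Pt n} : α.block v = 1 ↔ α.Last v := by
  unfold block
  split_ifs <;> simp_all

theorem Adm.block_neg (h : α.Adm) (v : Pt n) : α.block (-v) = -α.block v := by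
  have : α.Last v → ¬α.Last (-v) := h.neg_last
  unfold block
  rw [Pt.neg_neg]
  split_ifs <;> simp_all

theorem block_cases (v : Pt n) : α.block v = 1 ∨ α.block v = 0 ∨ α.block v = -1 := by
  unfold block
  split_ifs <;> simp

theorem Adm.block_eq_neg_one (h : α.Adm) {v : Pt n} : α.block v = -1 ↔ α.Last (-v) := by
  rw [← block_eq_one, h.block_neg]
  omega

theorem block_of_botRight {v : Pt n} (hv : α.BotRight v) : α.block v = 1 :=
  block_eq_one.mpr (Or.inl hv)

theorem block_of_le_top {v : Pt n} (hv : (v : ℤ) ≤ α.top) : α.block v = 1 ↔ α.BotRight v := by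
  rw [block_eq_one, Last]
  exact ⟨fun h => h.resolve_right fun h => by omega, Or.inl⟩

theorem block_of_topLeft {v : Pt n} (hv : α.TopLeft v) : α.block v ≤ 0 := by
  have h1 := (block_of_le_top hv.bounds.2).not.mpr hv.not_botRight
  have := block_cases (α := α) v
  omega

/-- A value above the top endpoint is never in the middle block: it is in the last one, unless its
negative is the bottom endpoint or a right point, and then it is in the first one. -/
theorem Adm.bounds_of_block_eq_zero (h : α.Adm) {v : Pt n} (hv : α.block v = 0) :
    (v : ℤ) ≤ α.top ∧ -(v : ℤ) ≤ α.top := by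
  have key : ∀ v : Pt n, α.block v = 0 → (v : ℤ) ≤ α.top := by
    intro v hv
    by_contra hc
    have h1 : ¬α.Last v := fun h => by have := block_eq_one.mpr h; omega
    have h2 : ¬α.Last (-v) := fun h' => by have := h.block_eq_neg_one.mpr h'; omega
    exact h1 (Or.inr ⟨by omega, fun h3 => h2 (Or.inl h3)⟩)
  refine ⟨key v hv, ?_⟩
  have := key (-v) (by rw [h.block_neg]; omega)
  rwa [Pt.coe_neg] at this

theorem Adm.block_of_symm (h : α.Adm) (hs : (α.bot : ℤ) = -α.top) (v : Pt n) :
    α.block v = 1 ∨ α.block v = -1 := by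
  by_contra hc
  have h0 : α.block v = 0 := by have := block_cases (α := α) v; omega
  have hb := h.bounds_of_block_eq_zero h0
  have h1 : ¬α.BotRight v := fun h => by have := block_of_botRight h; omega
  have h2 : ¬α.BotRight (-v) := fun h' => by
    have := block_of_botRight h'
    rw [h.block_neg] at this
    omega
  have h3 : (v : ℤ) ≠ α.bot := fun e => h1 (Or.inl (Pt.ext' e))
  have h4 : -(v : ℤ) ≠ α.bot := fun e => h2 (Or.inl (Pt.ext' e))
  rcases h.symm hs v (by omega) (by omega) with h5 | h5
  · exact h1 (Or.inr h5)
  · exact h2 (Or.inr h5)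

/-- The top endpoint falls into the first block only if the arc is symmetric, and then the middle
block is empty. -/
theorem Adm.block_topLeft_le (h : α.Adm) {v : Pt n} (hv : α.TopLeft v) :
    α.block v ≤ α.block α.top := by
  have h1 := block_of_topLeft hv
  have h2 := block_of_topLeft (α := α) topLeft_top
  have h3 := block_cases (α := α) α.top
  by_contra hc
  have h4 : α.block α.top = -1 := by have := block_cases (α := α) v; omega
  have h5 : α.BotRight (-α.top) := by
    rw [h.block_eq_neg_one] at h4
    refine h4.resolve_right fun h5 => ?_
    rw [Pt.coe_neg] at h5
    have := h.top_pos
    omega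
  rcases h5 with h5 | h5
  · rw [Pt.neg_eq_iff] at h5
    have := h.block_of_symm h5.symm v
    omega
  · exact h.neg_top h5

/-- `w` is sorted by blocks of `α`, and each block is increasing. -/
def IsJoinIrredOf (α : Arc n) (w : SignedPerm n) : Prop :=
  ∀ x y : Pt n, pos w x < pos w y ↔
    α.block x < α.block y ∨ α.block x = α.block y ∧ (x : ℤ) < y

theorem Adm.exists_isJoinIrredOf (h : α.Adm) : ∃ w, α.IsJoinIrredOf w := by
  -- Two values differ by at most `2n`, so the weight `2n + 1` makes the comparison lexicographic.
  have key : ∀ x y : Pt n, α.block x * (2 * n + 1) + x < α.block y * (2 * n + 1) + y ↔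
      α.block x < α.block y ∨ α.block x = α.block y ∧ (x : ℤ) < y := by
    intro x y
    have hx := abs_le.mp x.2.2
    have hy := abs_le.mp y.2.2
    rcases block_cases (α := α) x with h1 | h1 | h1 <;>
      rcases block_cases (α := α) y with h2 | h2 | h2 <;> rw [h1, h2] <;> omega
  obtain ⟨w, hw⟩ := exists_of_key (fun v => α.block v * (2 * n + 1) + v)
    (fun x => by rw [h.block_neg, Pt.coe_neg]; ring)
    (fun x y e => by
      have h1 := (key x y).not.mp e.not_lt
      have h2 := (key y x).not.mp e.not_gt
      exact Pt.ext' (by omega))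
  exact ⟨w, fun x y => (hw x y).trans (key x y)⟩

section JoinIrred

variable {j : SignedPerm n}

/-- A pair inverted in `j` has its smaller value in a later block, so in general the pair or its
negative is one of those that `α` requires. The exception is `a < -top` and `top < b`, where two
required pairs are chained. -/
theorem Adm.le_of_below (h : α.Adm) (hj : α.IsJoinIrredOf j) {w : SignedPerm n}
    (hw : α.Below w) : j ≤ w := by
  have key : ∀ a b : Pt n, (a : ℤ) < b → α.block a = 1 → (b : ℤ) ≤ α.top → α.block b ≤ 0 →
      pos w b < pos w a := by
    intro a b hab ha hb hb'
    have h1 := (block_of_le_top (by omega)).mp ha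
    refine hw a b h1 (topLeft_of_not_botRight (by have := h1.bounds; omega) hb fun h2 => ?_) hab
    have := block_of_botRight h2
    omega
  have key' : ∀ a b : Pt n, (a : ℤ) < b → α.block b = -1 → -(a : ℤ) ≤ α.top → 0 ≤ α.block a →
      pos w b < pos w a := by
    intro a b hab hb ha ha'
    have := key (-b) (-a) (by simp only [Pt.coe_neg]; omega) (by rw [h.block_neg]; omega)
      (by rwa [Pt.coe_neg]) (by rw [h.block_neg]; omega)
    simp only [pos_neg] at this
    omega
  rw [weak_le_iff]
  intro a b hab hlt
  rw [hj] at hlt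
  have hba : α.block b < α.block a := by omega
  have ha := block_cases (α := α) a
  have hb := block_cases (α := α) b
  by_cases h1 : α.block a = 1
  · by_cases h2 : (b : ℤ) ≤ α.top
    · exact key a b hab h1 h2 (by omega)
    · have hb' : α.block b = -1 := by
        by_contra hc
        have := h.bounds_of_block_eq_zero (v := b) (by omega)
        omega
      by_cases h3 : -(a : ℤ) ≤ α.top
      · exact key' a b hab hb' h3 (by omega)
      -- Here `b` precedes `-top`, as the negative of the required pair `-b`, `top`; and `-top`
      -- precedes `a`, since `-top` is a left point.
      · have := h.top_pos
        have h4 := key (-b) α.top (by rw [Pt.coe_neg]; omega) (by rw [h.block_neg]; omega)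
          le_rfl (block_of_topLeft topLeft_top)
        have h5 := (block_of_le_top (by omega)).mp h1
        have h6 := hw a (-α.top) h5 (topLeft_iff.mpr ⟨?_, ?_, h.neg_top⟩) (by rw [Pt.coe_neg]; omega)
        · simp only [pos_neg] at h4 h6
          omega
        · have := h5.bounds
          rw [Pt.coe_neg]
          omega
        · rw [Pt.coe_neg]
          omega
  · have h2 : α.block a = 0 := by omega
    exact key' a b hab (by omega) (h.bounds_of_block_eq_zero h2).2 (by omega)

theorem IsJoinIrredOf.below (hj : α.IsJoinIrredOf j) : α.Below j := by
  intro a b ha hb _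
  rw [hj]
  have := block_of_botRight ha
  have := block_of_topLeft hb
  omega

theorem Adm.le_iff_below (h : α.Adm) (hj : α.IsJoinIrredOf j) {w : SignedPerm n} :
    j ≤ w ↔ α.Below w :=
  ⟨fun hw => hj.below.mono hw, h.le_of_below hj⟩

/-- Since `z ≤ j`, pairs in order in `j` stay in order in `z`. So left points below the top endpoint
precede it, right points follow the bottom endpoint, and inverting the endpoints alone inverts every
required pair. This makes the lower cover of `j` unique. -/
theorem Adm.le_of_pos_lt (h : α.Adm) (hj : α.IsJoinIrredOf j) {z : SignedPerm n} (hz : z ≤ j)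
    (hlt : pos z α.top < pos z α.bot) : j ≤ z := by
  refine h.le_of_below hj fun a b ha hb hab => ?_
  rw [weak_le_iff] at hz
  have h1 : pos z b ≤ pos z α.top := by
    rcases lt_or_eq_of_le hb.bounds.2 with h1 | h1
    · by_contra hc
      have h2 := hz b α.top h1 (by omega)
      rw [hj] at h2
      have := h.block_topLeft_le hb
      omega
    · rw [Pt.ext' h1]
  have h2 : pos z α.bot ≤ pos z a := by
    rcases lt_or_eq_of_le ha.bounds.1 with h1 | h1
    · by_contra hc
      have h2 := hz α.bot a h1 (by omega)
      rw [hj] at h2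
      have := block_of_botRight ha
      have := block_of_botRight (α := α) botRight_bot
      omega
    · rw [Pt.ext' h1]
  omega

theorem Adm.adjacent (h : α.Adm) (hj : α.IsJoinIrredOf j) (v : Pt n) :
    ¬(pos j α.top < pos j v ∧ pos j v < pos j α.bot) := by
  rintro ⟨h1, h2⟩
  rw [hj] at h1 h2
  have hb := block_of_botRight (α := α) botRight_bot
  have ht := block_of_topLeft (α := α) topLeft_top
  have hv := block_cases (α := α) v
  have htc := block_cases (α := α) α.top
  have := h.top_pos
  have := α.bot_lt
  by_cases h3 : α.block v = 1
  · have := ((block_of_le_top (by omega)).mp h3).bounds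
    omega
  · by_cases h4 : α.block v = 0
    · have := h.bounds_of_block_eq_zero h4
      by_cases h5 : α.block α.top = 0
      · omega
      · have h6 : α.TopLeft v ∨ (v : ℤ) < α.bot := by
          by_cases h7 : (α.bot : ℤ) ≤ v
          · refine Or.inl (topLeft_of_not_botRight h7 (by omega) fun h8 => ?_)
            have := block_of_botRight h8
            omega
          · exact Or.inr (by omega)
        rcases h6 with h6 | h6
        · have := h.block_topLeft_le h6
          have := block_cases (α := α) α.top
          omega
        · have h7 : α.block α.top = -1 := by omega
          rw [h.block_eq_neg_one] at h7
          rcases h7 with (h8 | h8) | h8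
          · rw [Pt.neg_eq_iff] at h8
            omega
          · exact h.neg_top h8
          · rw [Pt.coe_neg] at h8
            omega
    · have h5 : α.block v = -1 := by omega
      have h6 : α.block (-v) = 1 := by rw [h.block_neg]; omega
      have h7 := ((block_of_le_top (by rw [Pt.coe_neg]; omega)).mp h6)
      have h8 := h7.bounds
      rw [Pt.coe_neg] at h8
      have h9 : α.block α.top = -1 := by omega
      rw [h.block_eq_neg_one] at h9
      rcases h9 with (h10 | h10) | h10
      · rw [Pt.neg_eq_iff] at h10
        omega
      · exact h.neg_top h10
      · rw [Pt.coe_neg] at h10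
        omega

/-- The element covered by the join-irreducible element `j` of `α`. -/
theorem Adm.exists_lower (h : α.Adm) (hj : α.IsJoinIrredOf j) :
    ∃ j', ∀ a b : Pt n, (a : ℤ) < b → (pos j' b < pos j' a ↔
      pos j b < pos j a ∧ ¬(a = α.bot ∧ b = α.top) ∧ ¬(a = -α.top ∧ b = -α.bot)) :=
  ⟨_, fun _ _ hab => pos_refl_mul_lt_iff α.bot_lt
    (hj.below _ _ botRight_bot topLeft_top α.bot_lt) (h.adjacent hj) hab⟩

end JoinIrred

end Arc

open Arc

/-! ### Arc diagrams of join-irreducible elements -/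

theorem arc_eq_of_mem_arcDiagram {w : SignedPerm n} {α β : Arc n} (hα : α ∈ arcDiagram w)
    (hβ : β ∈ arcDiagram w) (ht : α.top = β.top) (hb : α.bot = β.bot) : α = β := by
  obtain ⟨i, i', -, h1, h2, h3⟩ := hα
  obtain ⟨k, k', -, h4, h5, h6⟩ := hβ
  have e1 : i = k := w.1.injective (by rw [← h1, ← h4, ht])
  have e2 : i' = k' := w.1.injective (by rw [← h2, ← h5, hb])
  subst e1 e2
  exact Arc.ext hb ht (h3.trans h6.symm)

theorem symm_neg (w : SignedPerm n) (v : Pt n) : w.1.symm (-v) = -w.1.symm v := (w⁻¹).2 v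

theorem neg_mem_arcDiagram {w : SignedPerm n} {α : Arc n} (hα : α ∈ arcDiagram w) :
    -α ∈ arcDiagram w := by
  obtain ⟨i, i', h, h1, h2, h3⟩ := hα
  refine ⟨-i', -i, covBy_neg h, ?_, ?_, Set.ext fun v => ?_⟩
  · rw [Arc.neg_top, h2, apply_neg]
  · rw [Arc.neg_bot, h1, apply_neg]
  · rw [mem_neg_right, mem_left, h3, apply_neg, apply_neg, ← h1, ← h2]
    have hc := covBy_iff.mp h
    have hc' := hc.2 (-w.1.symm v)
    have e1 : (w.1.symm v : ℤ) = -i → (v : ℤ) = -α.top := fun e => by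
      have : w.1.symm v = -i := Pt.ext' e
      rw [Equiv.symm_apply_eq, apply_neg, ← h1] at this
      rw [this, Pt.coe_neg]
    have e2 : (w.1.symm v : ℤ) = -i' → (v : ℤ) = -α.bot := fun e => by
      have : w.1.symm v = -i' := Pt.ext' e
      rw [Equiv.symm_apply_eq, apply_neg, ← h2] at this
      rw [this, Pt.coe_neg]
    simp only [Set.mem_ofPred_eq, Set.mem_Ioo, symm_neg, Pt.lt_iff, Pt.coe_neg] at hc' ⊢
    omega

namespace Arc

variable {α : Arc n}

theorem Adm.bot_eq_of_block_top (h : α.Adm) (ht : α.block α.top ≠ 0) :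
    (α.bot : ℤ) = -α.top := by
  have h1 := block_of_topLeft (α := α) topLeft_top
  have h2 : α.block α.top = -1 := by have := block_cases (α := α) α.top; omega
  rw [h.block_eq_neg_one] at h2
  rcases h2 with (h3 | h3) | h3
  · rw [Pt.neg_eq_iff] at h3
    exact h3.symm
  · exact absurd h3 h.neg_top
  · rw [Pt.coe_neg] at h3
    have := h.top_pos
    omega

theorem bot_le_of_last {v : Pt n} (h : α.Last v) : (α.bot : ℤ) ≤ v := by
  have := α.bot_lt
  rcases h with h | h
  · exact h.bounds.1
  · omega

/-- A descent straddles a boundary of blocks. The last block starts with its least value, the bottom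
endpoint, and the block before it ends with its greatest value, the top endpoint; any other boundary
is the negative of this one. -/
theorem Adm.descent_eq (h : α.Adm) {j : SignedPerm n} (hj : α.IsJoinIrredOf j) {x y : Pt n}
    (hlt : (y : ℤ) < x) (hpos : pos j x < pos j y)
    (hadj : ∀ v, ¬(pos j x < pos j v ∧ pos j v < pos j y)) :
    x = α.top ∧ y = α.bot ∨ x = -α.bot ∧ y = -α.top := by
  have key : ∀ x y : Pt n, (y : ℤ) < x → pos j x < pos j y → α.block y = 1 →
      (∀ v, ¬(pos j x < pos j v ∧ pos j v < pos j y)) → x = α.top ∧ y = α.bot := by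
    intro x y hlt hpos hy hadj
    have hp := hpos
    rw [hj] at hp
    have hb := block_of_botRight (α := α) botRight_bot
    have ht := block_of_topLeft (α := α) topLeft_top
    have hx := block_cases (α := α) x
    have h1 : pos j α.bot ≤ pos j y := by
      by_contra hc
      have h2 := (hj y α.bot).mp (by omega)
      have := bot_le_of_last (block_eq_one.mp hy)
      omega
    have h2 : pos j x < pos j α.bot := (hj _ _).mpr (by omega)
    have h3 : y = α.bot := pos_inj j (by have := hadj α.bot; omega)
    refine ⟨pos_inj j ?_, h3⟩
    have h4 : pos j α.top < pos j y := (hj _ _).mpr (by omega)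
    have h5 : pos j x ≤ pos j α.top := by
      by_contra hc
      have h2 := (hj α.top x).mp (by omega)
      by_cases h6 : α.block α.top = 0
      · have := h.bounds_of_block_eq_zero (v := x) (by omega)
        omega
      · have h7 := h.bot_eq_of_block_top h6
        have h8 := h.block_of_symm h7 x
        have h9 : α.block (-x) = 1 := by rw [h.block_neg]; omega
        have := bot_le_of_last (block_eq_one.mp h9)
        rw [Pt.coe_neg] at this
        have := block_cases (α := α) α.top
        omega
    have := hadj α.top
    omega
  have hp := hpos
  rw [hj] at hp
  have hx := block_cases (α := α) x
  have hy := block_cases (α := α) y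
  by_cases h1 : α.block y = 1
  · exact Or.inl (key x y hlt hpos h1 hadj)
  · right
    have := key (-y) (-x) (by simp only [Pt.coe_neg]; omega) (by simp only [pos_neg]; omega)
      (by rw [h.block_neg]; omega) (fun v => by
        have := hadj (-v)
        simp only [pos_neg] at this ⊢
        omega)
    rw [← this.1, ← this.2, Pt.neg_neg, Pt.neg_neg]
    exact ⟨rfl, rfl⟩

theorem Adm.mem_arcDiagram (h : α.Adm) {j : SignedPerm n} (hj : α.IsJoinIrredOf j) :
    α ∈ arcDiagram j := by
  refine ⟨j.1.symm α.top, j.1.symm α.bot, covBy_iff.mpr ⟨?_, fun v hv => ?_⟩, ?_, ?_,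
    Set.ext fun v => ?_⟩
  · exact hj.below _ _ botRight_bot topLeft_top α.bot_lt
  · refine h.adjacent hj (j.1 v) ?_
    rw [pos_apply]
    exact hv
  · simp
  · simp
  · rw [Equiv.apply_symm_apply, Equiv.apply_symm_apply]
    constructor
    · intro hv
      refine ⟨α.right_subset hv, ?_⟩
      change pos j α.bot < pos j v
      rw [hj, block_of_botRight (Or.inr hv), block_of_botRight botRight_bot]
      exact Or.inr ⟨rfl, (right_bounds hv).1⟩
    · rintro ⟨hv, hlt⟩
      change pos j α.bot < pos j v at hlt
      rw [hj, block_of_botRight botRight_bot] at hlt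
      by_contra hc
      have := block_of_topLeft (α := α) (Or.inr ⟨hv, hc⟩)
      omega

theorem Adm.arcDiagram_eq (h : α.Adm) {j : SignedPerm n} (hj : α.IsJoinIrredOf j) :
    arcDiagram j = {α, -α} := by
  refine Set.Subset.antisymm (fun β hβ => ?_) ?_
  · have hβ' := hβ
    obtain ⟨i, i', hi, h1, h2, -⟩ := hβ'
    have hc := covBy_iff.mp hi
    have := h.descent_eq hj (x := β.top) (y := β.bot) β.bot_lt
      (by rw [h1, h2, pos_apply, pos_apply]; exact hc.1)
      (fun v => by rw [h1, h2, pos_apply, pos_apply]; exact hc.2 _)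
    rcases this with h3 | h3
    · exact Or.inl (arc_eq_of_mem_arcDiagram hβ (h.mem_arcDiagram hj) h3.1 h3.2)
    · exact Or.inr (arc_eq_of_mem_arcDiagram hβ (neg_mem_arcDiagram (h.mem_arcDiagram hj)) h3.1 h3.2)
  · rintro β (rfl | rfl)
    · exact h.mem_arcDiagram hj
    · exact neg_mem_arcDiagram (h.mem_arcDiagram hj)

end Arc

/-- Exchanging adjacent values `a < b` with `b` first gives an element that is covered. -/
theorem refl_mul_covBy {w : SignedPerm n} {a b : Pt n} (hab : (a : ℤ) < b)
    (h : pos w b < pos w a) (hadj : ∀ v, ¬(pos w b < pos w v ∧ pos w v < pos w a)) :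
    refl a b * w ⋖ w := by
  have key := fun x y => pos_refl_mul_lt_iff hab h hadj (x := x) (y := y)
  have hle : refl a b * w ≤ w := weak_le_iff.mpr fun x y hxy h1 => ((key x y hxy).mp h1).1
  refine ⟨lt_of_le_not_ge hle fun hc => ?_, fun u hu1 hu2 => ?_⟩
  · exact ((key a b hab).mp (weak_le_iff.mp hc a b hab h)).2.1 ⟨rfl, rfl⟩
  · by_cases hu : pos u b < pos u a
    · refine hu2.not_ge (weak_le_iff.mpr fun x y hxy h1 => ?_)
      by_cases h2 : x = a ∧ y = b
      · rw [h2.1, h2.2]; exact hu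
      · by_cases h3 : x = -b ∧ y = -a
        · rw [h3.1, h3.2, pos_neg, pos_neg]; omega
        · exact weak_le_iff.mp hu1.le x y hxy ((key x y hxy).mpr ⟨h1, h2, h3⟩)
    · refine hu1.not_ge (weak_le_iff.mpr fun x y hxy h1 => ?_)
      refine (key x y hxy).mpr ⟨weak_le_iff.mp hu2.le x y hxy h1, ?_, ?_⟩
      · rintro ⟨rfl, rfl⟩
        exact hu h1
      · rintro ⟨rfl, rfl⟩
        rw [pos_neg, pos_neg] at h1
        omega

/-- Each descent gives a lower cover, so a join-irreducible element has a single descent up to sign.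
The notation therefore consists of two or three increasing runs, and these are the blocks of the arc
of the descent. -/
theorem exists_adm_of_isJoinIrred {j : SignedPerm n} (h : Forcing.IsJoinIrred j) :
    ∃ α : Arc n, α.Adm ∧ α.IsJoinIrredOf j := by
  obtain ⟨x₀, hx₀, huniq⟩ := h
  have hcov : ∀ i k : Pt n, i ⋖ k → (j.1 k : ℤ) < j.1 i →
      refl (j.1 k) (j.1 i) * j ⋖ j := by
    intro i k hik hlt
    refine refl_mul_covBy hlt (by rw [pos_apply, pos_apply]; exact hik.1) fun v => ?_
    rw [pos_apply, pos_apply]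
    exact (covBy_iff.mp hik).2 _
  have hd : ∃ i k : Pt n, i ⋖ k ∧ (j.1 k : ℤ) < j.1 i := by
    by_contra hc
    push Not at hc
    refine hx₀.lt.not_ge (weak_le_iff.mpr fun a b hab h1 => ?_)
    have := lt_of_no_descent j (x := j.1.symm b) (y := j.1.symm a) h1
      fun i k hik _ _ => not_lt.mpr (hc i k hik)
    rw [Equiv.apply_symm_apply, Equiv.apply_symm_apply] at this
    omega
  -- Of the descent and its negative, take the one that ends at a positive position, so that the
  -- last run starts at `k`.
  obtain ⟨i, k, hik, hlt, hk⟩ : ∃ i k : Pt n, i ⋖ k ∧ (j.1 k : ℤ) < j.1 i ∧ 0 < (k : ℤ) := by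
    obtain ⟨i, k, hik, hlt⟩ := hd
    by_cases hk : 0 < (k : ℤ)
    · exact ⟨i, k, hik, hlt, hk⟩
    · refine ⟨-k, -i, covBy_neg hik, ?_, ?_⟩
      · rw [apply_neg, apply_neg, Pt.coe_neg, Pt.coe_neg]
        omega
      · have := hik.1
        rw [Pt.lt_iff] at this
        rw [Pt.coe_neg]
        omega
  have hdesc : ∀ c d : Pt n, c ⋖ d → (j.1 d : ℤ) < j.1 c →
      (c : ℤ) = i ∧ (d : ℤ) = k ∨ (c : ℤ) = -k ∧ (d : ℤ) = -i := by
    intro c d hcd hlt'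
    have e : refl (j.1 k) (j.1 i) * j = refl (j.1 d) (j.1 c) * j :=
      (huniq _ (hcov i k hik hlt)).trans (huniq _ (hcov c d hcd hlt')).symm
    have h1 := pos_refl_mul_lt_iff (w := j) hlt (by rw [pos_apply, pos_apply]; exact hik.1)
      (fun v => by rw [pos_apply, pos_apply]; exact (covBy_iff.mp hik).2 _) hlt'
    have h2 := pos_refl_mul_lt_iff (w := j) hlt' (by rw [pos_apply, pos_apply]; exact hcd.1)
      (fun v => by rw [pos_apply, pos_apply]; exact (covBy_iff.mp hcd).2 _) hlt'
    rw [e, h2] at h1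
    have h3 : pos j (j.1 c) < pos j (j.1 d) := by rw [pos_apply, pos_apply]; exact hcd.1
    simp only [← apply_neg, EmbeddingLike.apply_eq_iff_eq, Pt.eq_iff, Pt.coe_neg] at h1
    tauto
  have hinc : ∀ u v : Pt n, pos j u < pos j v → ¬(pos j u ≤ i ∧ k ≤ pos j v) →
      ¬(pos j u ≤ -k ∧ -i ≤ pos j v) → (u : ℤ) < v := by
    intro u v huv h1 h2
    have := lt_of_no_descent j (x := j.1.symm u) (y := j.1.symm v) huv fun c d hcd hc hd hlt' => by
      change pos j u ≤ c at hc
      change d ≤ pos j v at hd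
      have := hdesc c d hcd hlt'
      omega
    simpa using this
  have hgap : ∀ v, pos j v ≤ i ∨ k ≤ pos j v := fun v => by
    have := (covBy_iff.mp hik).2 (j.1.symm v)
    change ¬((i : ℤ) < pos j v ∧ pos j v < k) at this
    omega
  have hik' : (i : ℤ) < k ∧ -(k : ℤ) ≤ i ∧ (0 < (i : ℤ) ∨ (i : ℤ) = -k) := by
    have h1 := hik.1
    have h2 := i.ne_zero
    rw [Pt.lt_iff] at h1
    have h3 := covBy_cases hik
    omega
  let α : Arc n :=
    { bot := j.1 k
      top := j.1 i
      bot_lt_top := hlt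
      right := {v | v ∈ Set.Ioo (j.1 k) (j.1 i) ∧ (k : ℤ) < pos j v}
      right_subset := fun v hv => hv.1 }
  have hbot : pos j α.bot = k := pos_apply j k
  have htop : pos j α.top = i := pos_apply j i
  have hright : ∀ v, v ∈ α.right ↔ ((α.bot : ℤ) < v ∧ (v : ℤ) < α.top) ∧ (k : ℤ) < pos j v :=
    fun v => Iff.rfl
  have hbt := α.bot_lt
  have hpe : ∀ u v, pos j u = pos j v ↔ (u : ℤ) = v := fun u v =>
    ⟨fun e => by rw [pos_inj j e], fun e => by rw [Pt.ext' e]⟩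
  have htp : 0 < (α.top : ℤ) := by
    have h1 := hinc (-α.top) α.top
    have h2 := (hpe (-α.bot) α.top)
    simp only [pos_neg, Pt.coe_neg, htop, hbot] at h1 h2
    have := i.ne_zero
    omega
  have hBR : ∀ v, α.BotRight v ↔ (k : ℤ) ≤ pos j v ∧ (v : ℤ) < α.top := by
    intro v
    unfold BotRight
    rw [hright, Pt.eq_iff, ← hpe, hbot]
    have h1 := hinc α.bot v
    have h2 := hpe v α.bot
    rw [hbot] at h1 h2
    omega
  have hmid : ∀ v, pos j v ≤ i → -(k : ℤ) < pos j v → (v : ℤ) ≤ α.top := by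
    intro v h1 h2
    have h3 := hinc v α.top
    have h4 := hpe v α.top
    have h5 := hgap (-v)
    rw [pos_neg] at h5
    rw [htop] at h3 h4
    omega
  have hlast : ∀ v, α.Last v ↔ (k : ℤ) ≤ pos j v := by
    intro v
    unfold Last
    have h1 := hmid v
    have h2 := hgap v
    have h3 := hpe v α.top
    rw [htop] at h3
    rw [hBR, hBR, pos_neg, Pt.coe_neg]
    omega
  have hAdm : α.Adm :=
    { top_pos := htp
      neg_right := fun v hv hv' => by
        rw [hright] at hv hv'
        rw [pos_neg] at hv'
        omega
      neg_bot := fun h => by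
        rw [hright, pos_neg, hbot] at h
        omega
      neg_top := fun h => by
        rw [hright, pos_neg, htop] at h
        omega
      symm := fun hs v h1 h2 => by
        have h3 : pos j α.bot = pos j (-α.top) := (hpe _ _).mpr (by rw [Pt.coe_neg, hs])
        rw [hbot, pos_neg, htop] at h3
        have h4 := hpe v α.bot
        have h5 := hpe v α.top
        have h6 := hgap v
        rw [hright, hright, pos_neg, Pt.coe_neg]
        rw [hbot] at h4
        rw [htop] at h5
        omega }
  refine ⟨α, hAdm, fun x y => ?_⟩
  have hblock : ∀ v, α.block v = 1 ∧ (k : ℤ) ≤ pos j v ∨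
      α.block v = -1 ∧ pos j v ≤ -k ∨ α.block v = 0 ∧ -(k : ℤ) < pos j v ∧ pos j v < k := by
    intro v
    have h1 := block_eq_one (α := α) (v := v)
    have h2 := hAdm.block_eq_neg_one (v := v)
    have h3 := block_cases (α := α) v
    rw [hlast] at h1 h2
    rw [pos_neg] at h2
    omega
  have h1 := hblock x
  have h2 := hblock y
  have h3 := hinc x y
  have h4 := hinc y x
  have h5 := hpe x y
  have h6 := hgap x
  have h7 := hgap y
  have h8 := hgap (-x)
  have h9 := hgap (-y)
  rw [pos_neg] at h8 h9
  rcases h1 with h1 | h1 | h1 <;> rcases h2 with h2 | h2 | h2 <;> omega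

namespace Arc

variable {α β γ : Arc n}

/-! ### Subarcs -/

/-- `β` is obtained by restricting `α` to a smaller interval. -/
def IsRestriction (β α : Arc n) : Prop :=
  (α.bot : ℤ) ≤ β.bot ∧ (β.top : ℤ) ≤ α.top ∧
    ∀ v : Pt n, (β.bot : ℤ) < v → (v : ℤ) < β.top → (v ∈ β.right ↔ v ∈ α.right)

/-- The endpoints have the same sign. -/
def NonOverlapping (α : Arc n) : Prop := 0 < (α.bot : ℤ) ∨ (α.top : ℤ) < 0

/-- `α` or `-α` represents a join-irreducible element. -/
def Good (α : Arc n) : Prop := α.NonOverlapping ∨ α.Adm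

/-- `β` is a restriction of `α` representing, up to sign, a join-irreducible element that forces
the one of `α`. -/
def IsSub (β α : Arc n) : Prop :=
  β.IsRestriction α ∧ (β.NonOverlapping ∨
    β.Adm ∧ ((α.bot : ℤ) = -α.top → (β.bot : ℤ) = -β.top))

theorem IsSub.good (h : β.IsSub α) : β.Good := h.2.imp id And.left

theorem IsRestriction.refl (α : Arc n) : α.IsRestriction α :=
  ⟨le_rfl, le_rfl, fun _ _ _ => Iff.rfl⟩

theorem IsRestriction.trans (h₁ : γ.IsRestriction β) (h₂ : β.IsRestriction α) :
    γ.IsRestriction α := by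
  obtain ⟨a1, a2, a3⟩ := h₁
  obtain ⟨b1, b2, b3⟩ := h₂
  exact ⟨by omega, by omega, fun v h1 h2 => (a3 v h1 h2).trans (b3 v (by omega) (by omega))⟩

theorem Good.isSub_self (h : α.Good) : α.IsSub α :=
  ⟨.refl α, h.imp id fun h => ⟨h, id⟩⟩

theorem IsSub.trans (h₁ : γ.IsSub β) (h₂ : β.IsSub α) : γ.IsSub α := by
  refine ⟨h₁.1.trans h₂.1, ?_⟩
  have := h₁.1.1
  have := h₁.1.2.1
  rcases h₂.2 with h | h
  · refine Or.inl (h.imp ?_ ?_) <;> omega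
  · exact h₁.2.imp id fun h' => ⟨h'.1, fun e => h'.2 (h.2 e)⟩

/-! ### Reflection and half turn of subarcs -/

theorem IsRestriction.rev (h : β.IsRestriction α) : β.rev.IsRestriction α.rev := by
  obtain ⟨h1, h2, h3⟩ := h
  refine ⟨?_, ?_, fun v => ?_⟩
  · simp only [rev_bot, Pt.coe_neg]; omega
  · simp only [rev_top, Pt.coe_neg]; omega
  · have := h3 (-v)
    simp only [rev_bot, rev_top, Pt.coe_neg, mem_rev_right] at this ⊢
    intro h4 h5
    exact this (by omega) (by omega)

theorem IsRestriction.neg (h : β.IsRestriction α) : (-β).IsRestriction (-α) := by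
  obtain ⟨h1, h2, h3⟩ := h
  refine ⟨?_, ?_, fun v => ?_⟩
  · simp only [Arc.neg_bot, Pt.coe_neg]; omega
  · simp only [Arc.neg_top, Pt.coe_neg]; omega
  · have := h3 (-v)
    simp only [Arc.neg_bot, Arc.neg_top, Pt.coe_neg, mem_neg_right, mem_left] at this ⊢
    intro h4 h5
    have h6 := this (by omega) (by omega)
    rw [h6]
    exact and_congr_left fun _ => by omega

theorem NonOverlapping.rev (h : α.NonOverlapping) : α.rev.NonOverlapping := by
  unfold NonOverlapping at *
  simp only [rev_bot, rev_top, Pt.coe_neg]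
  omega

theorem NonOverlapping.neg (h : α.NonOverlapping) : (-α).NonOverlapping := by
  unfold NonOverlapping at *
  simp only [Arc.neg_bot, Arc.neg_top, Pt.coe_neg]
  omega

theorem Adm.rev (h : α.Adm) (hb : (α.bot : ℤ) < 0) : α.rev.Adm where
  top_pos := by rw [rev_top, Pt.coe_neg]; omega
  neg_right := fun v hv => by
    rw [mem_rev_right] at hv ⊢
    exact h.neg_right _ hv
  neg_bot := by
    rw [mem_rev_right, rev_bot, Pt.neg_neg]
    exact h.neg_top
  neg_top := by
    rw [mem_rev_right, rev_top, Pt.neg_neg]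
    exact h.neg_bot
  symm := fun hs v h1 h2 => by
    simp only [rev_bot, rev_top, Pt.coe_neg, mem_rev_right] at *
    exact h.symm (by omega) (-v) (by rw [Pt.coe_neg]; omega) (by rw [Pt.coe_neg]; omega)

theorem bot_neg_or_pos (α : Arc n) : (α.bot : ℤ) < 0 ∨ 0 < (α.bot : ℤ) := by
  have := α.bot.ne_zero
  omega

theorem Good.rev (h : α.Good) : α.rev.Good := by
  rcases h with h | h
  · exact Or.inl h.rev
  · rcases α.bot_neg_or_pos with hb | hb
    · exact Or.inr (h.rev hb)
    · exact Or.inl (NonOverlapping.rev (Or.inl hb))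

theorem IsSub.rev (h : β.IsSub α) : β.rev.IsSub α.rev := by
  refine ⟨h.1.rev, ?_⟩
  rcases h.2 with h' | h'
  · exact Or.inl h'.rev
  · rcases β.bot_neg_or_pos with hb | hb
    · refine Or.inr ⟨h'.1.rev hb, fun e => ?_⟩
      have := h'.2
      simp only [rev_bot, rev_top, Pt.coe_neg] at *
      omega
    · exact Or.inl (NonOverlapping.rev (Or.inl hb))

theorem adm_of_bot_pos (h : 0 < (α.bot : ℤ)) : α.Adm := by
  have hb := α.bot_lt
  refine ⟨by omega, fun v hv hv' => ?_, fun hv => ?_, fun hv => ?_, fun hs => by omega⟩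
  · have := right_bounds hv
    have := right_bounds hv'
    rw [Pt.coe_neg] at this
    omega
  · have := right_bounds hv
    rw [Pt.coe_neg] at this
    omega
  · have := right_bounds hv
    rw [Pt.coe_neg] at this
    omega

theorem Good.adm_or_neg (h : α.Good) : α.Adm ∨ (-α).Adm := by
  rcases h with (h | h) | h
  · exact Or.inl (adm_of_bot_pos h)
  · refine Or.inr (adm_of_bot_pos ?_)
    rw [Arc.neg_bot, Pt.coe_neg]
    omega
  · exact Or.inl h

theorem Good.exists_le_iff (h : α.Good) : ∃ j : SignedPerm n, ∀ w, j ≤ w ↔ α.Below w := by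
  rcases h.adm_or_neg with h | h
  · obtain ⟨j, hj⟩ := h.exists_isJoinIrredOf
    exact ⟨j, fun w => h.le_iff_below hj⟩
  · obtain ⟨j, hj⟩ := h.exists_isJoinIrredOf
    exact ⟨j, fun w => (h.le_iff_below hj).trans below_neg⟩

theorem Good.exists_le_iff_above (h : α.Good) :
    ∃ m : SignedPerm n, ∀ w, w ≤ m ↔ α.Above w := by
  obtain ⟨j, hj⟩ := h.rev.exists_le_iff
  refine ⟨longest n * j, fun w => ?_⟩
  rw [le_longest_mul, hj, below_rev]

/-- The restriction of an arc to the interval between `a` and `b`. -/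
def restrict (α : Arc n) (a b : Pt n) (hab : (a : ℤ) < b) : Arc n where
  bot := a
  top := b
  bot_lt_top := hab
  right := α.right ∩ Set.Ioo a b
  right_subset := Set.inter_subset_right

section Restrict

variable {a b : Pt n} {hab : (a : ℤ) < b}

theorem mem_restrict_right {v : Pt n} :
    v ∈ (α.restrict a b hab).right ↔ v ∈ α.right ∧ (a : ℤ) < v ∧ (v : ℤ) < b := Iff.rfl

theorem restrict_bot : (α.restrict a b hab).bot = a := rfl

theorem restrict_top : (α.restrict a b hab).top = b := rfl

theorem isRestriction_restrict (ha : (α.bot : ℤ) ≤ a) (hb : (b : ℤ) ≤ α.top) :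
    (α.restrict a b hab).IsRestriction α :=
  ⟨ha, hb, fun _ h1 h2 => ⟨fun h => h.1, fun h => ⟨h, h1, h2⟩⟩⟩

theorem IsRestriction.restrict (h : β.IsRestriction α) (ha : (a : ℤ) ≤ β.bot)
    (hb : (β.top : ℤ) ≤ b) : β.IsRestriction (α.restrict a b hab) := by
  refine ⟨ha, hb, fun v h1 h2 => ?_⟩
  rw [h.2.2 v h1 h2, mem_restrict_right]
  exact ⟨fun h => ⟨h, by omega, by omega⟩, And.left⟩

theorem botRight_restrict {v : Pt n} : (α.restrict a b hab).BotRight v ↔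
    v = a ∨ v ∈ α.right ∧ (a : ℤ) < v ∧ (v : ℤ) < b := Iff.rfl

theorem topLeft_restrict {v : Pt n} : (α.restrict a b hab).TopLeft v ↔
    v = b ∨ v ∉ α.right ∧ (a : ℤ) < v ∧ (v : ℤ) < b := by
  rw [topLeft_iff, restrict_bot, restrict_top, mem_restrict_right, Pt.eq_iff]
  by_cases h : v ∈ α.right <;> simp only [h, true_and, false_and, not_false_eq_true, not_true,
    and_true, or_false] <;> omega

end Restrict

/-! ### A subarc below a signed permutation that is not above an arc -/

section Extract

variable {w : SignedPerm n} {a b : Pt n}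

/-- By minimality, between `a` and `b` the points not right of `α` precede `b`, then comes `a`, then
the right points. The restriction to `[a, b]` works unless it is inadmissible, and then it is
lengthened downwards until it becomes admissible. -/
theorem Adm.exists_isSub_below_of_minimal (h : α.Adm) (ha : α.BotLeft a) (hb : α.TopRight b)
    (hw : pos w b < pos w a)
    (hmin : ∀ x y : Pt n, α.BotLeft x → α.TopRight y → (x : ℤ) < y → (y - x : ℤ) < b - a →
      pos w x < pos w y)
    (hab : (a : ℤ) < b) (hβ : (α.restrict a b hab).Below w)
    (ha0 : (a : ℤ) < 0) (hb0 : 0 < (b : ℤ))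
    (hs : (α.bot : ℤ) = -α.top → -(a : ℤ) ≤ b) :
    ∃ β : Arc n, β.IsSub α ∧ β.Below w ∧ α.BotLeft β.bot ∧ α.TopRight β.top := by
  have hab' := ha.bounds
  have hbb' := hb.bounds
  have ha' := (botLeft_iff.mp ha).2.2
  have hnb : -b ∉ α.right := by
    rcases hb with rfl | hb
    · exact h.neg_top
    · exact h.neg_right _ hb
  have N1 : ∀ u : Pt n, u ∉ α.right → (a : ℤ) < u → (u : ℤ) < b → pos w u < pos w b :=
    fun u hu h1 h2 => hmin u b (botLeft_iff.mpr ⟨by omega, by omega, hu⟩) hb h2 (by omega)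
  have N2 : ∀ u : Pt n, u ∈ α.right → (a : ℤ) < u → (u : ℤ) < b → pos w a < pos w u :=
    fun u hu h1 h2 => hmin a u ha (Or.inr hu) h1 (by omega)
  -- The only obstacle to using `[a, b]` is that `-a` may be a right point inside the interval. In
  -- that case `a`, and hence `b`, has negative position.
  by_cases hC : -a ∈ α.right ∧ -(a : ℤ) < b
  · obtain ⟨hna, hnab⟩ := hC
    have hpa := N2 (-a) hna (by rw [Pt.coe_neg]; omega) (by rw [Pt.coe_neg]; omega)
    rw [pos_neg] at hpa
    -- The candidates `l` for the new bottom are the points not right of `α` for which `-l` is not a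
    -- right point inside the new arc. The largest is taken, so that every point between `l` and `a`
    -- that is not right has its negative right; `N1` and `N2` then control the positions between
    -- `l` and `a` through their negatives.
    let S : Set (Pt n) := {l | -(b : ℤ) ≤ l ∧ (l : ℤ) < a ∧ (α.bot : ℤ) ≤ l ∧ l ∉ α.right ∧
      ((l : ℤ) = -b ∨ -l ∉ α.right)}
    have hS : S.Nonempty := by
      by_cases h1 : (α.bot : ℤ) ≤ -b
      · exact ⟨-b, by rw [Pt.coe_neg], by rw [Pt.coe_neg]; omega, by rwa [Pt.coe_neg], hnb,
          Or.inl (Pt.coe_neg b)⟩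
      · refine ⟨α.bot, by omega, lt_of_le_of_ne hab'.1 fun e => ?_, le_rfl, bot_notMem,
          Or.inr h.neg_bot⟩
        rw [← Pt.ext' e] at hna
        exact h.neg_bot hna
    obtain ⟨l, ⟨hl1, hl2, hl3, hl4, hl5⟩, hmax⟩ :=
      Set.exists_max_image S (fun v => (v : ℤ)) (Set.toFinite S) hS
    have hmax' : ∀ v : Pt n, (l : ℤ) < v → (v : ℤ) < a → v ∉ α.right → -v ∈ α.right := by
      intro v h1 h2 h3
      by_contra hc
      have := hmax v ⟨by omega, h2, by omega, h3, Or.inr hc⟩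
      omega
    have hpl : -pos w b ≤ pos w l := by
      rcases hl5 with h1 | h1
      · have : l = -b := Pt.ext' h1
        rw [this, pos_neg]
      · by_cases h2 : (l : ℤ) = -b
        · have : l = -b := Pt.ext' h2
          rw [this, pos_neg]
        · have := N1 (-l) h1 (by rw [Pt.coe_neg]; omega) (by rw [Pt.coe_neg]; omega)
          rw [pos_neg] at this
          omega
    have N3 : ∀ v : Pt n, (l : ℤ) < v → (v : ℤ) < a → v ∉ α.right → pos w v < -pos w a := by
      intro v h1 h2 h3
      have := N2 (-v) (hmax' v h1 h2 h3) (by rw [Pt.coe_neg]; omega) (by rw [Pt.coe_neg]; omega)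
      rw [pos_neg] at this
      omega
    have N4 : ∀ v : Pt n, (l : ℤ) < v → (v : ℤ) < a → v ∈ α.right → -pos w b < pos w v := by
      intro v h1 h2 h3
      have := N1 (-v) (h.neg_right v h3) (by rw [Pt.coe_neg]; omega) (by rw [Pt.coe_neg]; omega)
      rw [pos_neg] at this
      omega
    have hlb : (l : ℤ) < b := by omega
    have hlL : α.BotLeft l := botLeft_iff.mpr ⟨hl3, by omega, hl4⟩
    refine ⟨α.restrict l b hlb, ⟨isRestriction_restrict hl3 hbb'.2, Or.inr ⟨⟨hb0, ?_, ?_, ?_, ?_⟩,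
      ?_⟩⟩, ?_, hlL, hb⟩
    · intro v hv hv'
      exact h.neg_right v hv.1 hv'.1
    · rintro ⟨h1, h2⟩
      rcases hl5 with h3 | h3
      · have h4 := h2.2
        rw [Pt.lt_iff, Pt.coe_neg] at h4
        change -(l : ℤ) < b at h4
        omega
      · exact h3 h1
    · exact fun h1 => hnb h1.1
    · intro hlb' v h1 h2
      rw [restrict_bot] at hlb' h1
      rw [restrict_top] at hlb' h2
      rw [mem_restrict_right, mem_restrict_right, Pt.coe_neg]
      by_contra hc
      have h3 : v ∉ α.right := fun h3 => hc (Or.inl ⟨h3, h1, h2⟩)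
      have h4 : -v ∉ α.right := fun h3 => hc (Or.inr ⟨h3, by omega, by omega⟩)
      have h5 : (v : ℤ) ≠ -a := fun e => h3 (by
        have : v = -a := Pt.ext' e
        rwa [this])
      have h6 : (v : ℤ) ≠ a := fun e => h4 (by rwa [Pt.ext' e])
      rcases lt_or_gt_of_ne h6 with h7 | h7
      · exact h4 (hmax' v h1 h7 h3)
      · rcases lt_or_gt_of_ne h5 with h8 | h8
        · have h9 := N1 v h3 h7 h2
          -- Both `v` and `-v` would precede `b`, whose position is negative, although their
          -- positions are opposite.
          have h10 := N1 (-v) h4 (by rw [Pt.coe_neg]; omega) (by rw [Pt.coe_neg]; omega)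
          rw [pos_neg] at h10
          omega
        · have := hmax' (-v) (by rw [Pt.coe_neg]; omega) (by rw [Pt.coe_neg]; omega) h4
          rw [Pt.neg_neg] at this
          exact h3 this
    · intro hsα
      rw [restrict_bot, restrict_top]
      by_contra hc
      have h1 := hl5.resolve_left hc
      rcases h.symm hsα l (by omega) (by omega) with h2 | h2
      · exact hl4 h2
      · exact h1 h2
    · intro x y hx hy hxy
      rw [botRight_restrict] at hx
      rw [topLeft_restrict] at hy
      by_cases hya : (y : ℤ) < a
      · have h1 : pos w y < -pos w a := by
          rcases hy with rfl | hy
          · omega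
          · exact N3 y hy.2.1 hya hy.1
        rcases hx with rfl | hx
        · omega
        · have := N4 x hx.2.1 (by omega) hx.1
          omega
      · have h1 : (y : ℤ) = a ∧ pos w y = pos w a ∨ (a : ℤ) < y ∧ pos w y ≤ pos w b := by
          by_cases h2 : (y : ℤ) = a
          · exact Or.inl ⟨h2, by rw [Pt.ext' h2]⟩
          · rcases hy with rfl | hy
            · exact Or.inr ⟨hab, le_rfl⟩
            · exact Or.inr ⟨by omega, (N1 y hy.1 (by omega) hy.2.2).le⟩
        rcases hx with rfl | hx
        · omega
        · rcases lt_trichotomy (x : ℤ) a with h2 | h2 | h2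
          · have := N4 x hx.2.1 h2 hx.1
            omega
          · rw [Pt.ext' h2] at hx
            exact absurd hx.1 ha'
          · have := N2 x hx.1 h2 hx.2.2
            omega
  · refine ⟨_, ⟨isRestriction_restrict hab'.1 hbb'.2, Or.inr ⟨⟨hb0, ?_, ?_, ?_, ?_⟩, ?_⟩⟩,
      hβ, ha, hb⟩
    · intro v hv hv'
      exact h.neg_right v hv.1 hv'.1
    · rintro ⟨h1, h2⟩
      have h4 := h2.2
      rw [Pt.lt_iff, Pt.coe_neg] at h4
      exact hC ⟨h1, h4⟩
    · exact fun h1 => hnb h1.1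
    · intro hab'' v h1 h2
      rw [restrict_bot] at hab'' h1
      rw [restrict_top] at hab'' h2
      rw [mem_restrict_right, mem_restrict_right, Pt.coe_neg]
      by_contra hc
      have h3 : v ∉ α.right := fun h3 => hc (Or.inl ⟨h3, h1, h2⟩)
      have h4 : -v ∉ α.right := fun h3 => hc (Or.inr ⟨h3, by omega, by omega⟩)
      have h9 := N1 v h3 h1 h2
      have h10 := N1 (-v) h4 (by rw [Pt.coe_neg]; omega) (by rw [Pt.coe_neg]; omega)
      have h11 : a = -b := Pt.ext' hab''
      rw [h11, pos_neg] at hw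
      rw [pos_neg] at h10
      omega
    · intro hsα
      rw [restrict_bot, restrict_top]
      by_contra hc
      have h1 := hs hsα
      have h2 : (α.bot : ℤ) < a := by omega
      rcases h.symm hsα a h2 hab'.2 with h3 | h3
      · exact ha' h3
      · exact hC ⟨h3, by omega⟩

/-- The key lemma. Among the inverted pairs that violate `Above`, choose one with `b - a` least;
every required pair of the restriction to `[a, b]` is then inverted too. -/
theorem Good.exists_isSub_below (hα : α.Good) (ha : α.BotLeft a) (hb : α.TopRight b)
    (hab : (a : ℤ) < b) (hw : pos w b < pos w a) :
    ∃ β : Arc n, β.IsSub α ∧ β.Below w ∧ α.BotLeft β.bot ∧ α.TopRight β.top := by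
  induction hk : (b - a : ℤ).toNat using Nat.strong_induction_on generalizing a b with
  | _ k ih =>
  by_cases hex : ∃ x y : Pt n, α.BotLeft x ∧ α.TopRight y ∧ (x : ℤ) < y ∧
      (y - x : ℤ) < b - a ∧ pos w y < pos w x
  · obtain ⟨x, y, hx, hy, hxy, hlt, hw'⟩ := hex
    exact ih _ (by omega) hx hy hxy hw' rfl
  have hmin : ∀ x y : Pt n, α.BotLeft x → α.TopRight y → (x : ℤ) < y → (y - x : ℤ) < b - a →
      pos w x < pos w y := by
    intro x y hx hy hxy hlt
    by_contra hc
    exact hex ⟨x, y, hx, hy, hxy, hlt, pos_lt_of_not_lt (by omega) hc⟩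
  have hab' := ha.bounds
  have hbb' := hb.bounds
  have hβ : (α.restrict a b hab).Below w := by
    intro x y hx hy hxy
    rw [botRight_restrict] at hx
    rw [topLeft_restrict] at hy
    have h1 : pos w a ≤ pos w x := by
      rcases hx with rfl | hx
      · exact le_rfl
      · exact (hmin a x ha (Or.inr hx.1) hx.2.1 (by omega)).le
    have h2 : pos w y ≤ pos w b := by
      rcases hy with rfl | hy
      · exact le_rfl
      · exact (hmin y b (botLeft_iff.mpr ⟨by omega, by omega, hy.1⟩) hb hy.2.2 (by omega)).le
    omega
  by_cases hno : (α.restrict a b hab).NonOverlapping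
  · exact ⟨_, ⟨isRestriction_restrict hab'.1 hbb'.2, Or.inl hno⟩, hβ, ha, hb⟩
  have hno' : (a : ℤ) < 0 ∧ 0 < (b : ℤ) := by
    unfold NonOverlapping at hno
    rw [restrict_bot, restrict_top] at hno
    have := a.ne_zero
    have := b.ne_zero
    omega
  have h : α.Adm := by
    refine hα.resolve_left fun h1 => ?_
    unfold NonOverlapping at h1
    omega
  by_cases hs : (α.bot : ℤ) = -α.top → -(a : ℤ) ≤ b
  · exact h.exists_isSub_below_of_minimal ha hb hw hmin hab hβ hno'.1 hno'.2 hs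
  -- For symmetric `α`, the pair `-b`, `-a` is also a violating pair of the same length, and it
  -- satisfies the remaining hypothesis.
  · push Not at hs
    have hna : α.BotLeft (-b) := by
      have h1 := (Pt.coe_neg b)
      refine botLeft_iff.mpr ⟨by omega, by omega, ?_⟩
      rcases hb with rfl | hb
      · exact h.neg_top
      · exact h.neg_right b hb
    have hnb : α.TopRight (-a) := by
      rcases ha with ha | ha
      · left
        rw [Pt.neg_eq_iff, ha]
        omega
      · right
        refine (h.symm hs.1 a ha.1.1 ha.1.2).resolve_left ha.2
    have hab2 : ((-b : Pt n) : ℤ) < (-a : Pt n) := by simp only [Pt.coe_neg]; omega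
    refine h.exists_isSub_below_of_minimal hna hnb (by simp only [pos_neg]; omega) ?_ hab2 ?_
      (by rw [Pt.coe_neg]; omega) (by rw [Pt.coe_neg]; omega) (fun _ => by
        simp only [Pt.coe_neg]; omega)
    · intro x y hx hy hxy hlt
      simp only [Pt.coe_neg] at hlt
      exact hmin x y hx hy hxy (by omega)
    · intro x y hx hy hxy
      rw [botRight_restrict] at hx
      rw [topLeft_restrict] at hy
      have h1 : pos w (-b) ≤ pos w x := by
        rcases hx with rfl | hx
        · exact le_rfl
        · exact (hmin (-b) x hna (Or.inr hx.1) hx.2.1 (by simp only [Pt.coe_neg] at *; omega)).le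
      have h2 : pos w y ≤ pos w (-a) := by
        rcases hy with rfl | hy
        · exact le_rfl
        · have := Pt.coe_neg a
          have := Pt.coe_neg b
          exact (hmin y (-a) (botLeft_iff.mpr ⟨by omega, by omega, hy.1⟩) hnb hy.2.2
            (by omega)).le
      simp only [pos_neg] at h1 h2
      omega

end Extract

/-! ### The congruence whose uncontracted join-irreducible elements come from subarcs -/

/-- A violation of `Above` in `x` yields a subarc `γ` below `x`, hence below `y`. The endpoints of
`γ` are then a violation in `y`. -/
theorem above_of_below_imp {x y : SignedPerm n}
    (h : ∀ β : Arc n, β.IsSub α → β.Below x → β.Below y) (hβ : β.IsSub α) (hy : β.Above y) :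
    β.Above x := by
  intro a b ha hb hab
  by_contra hc
  obtain ⟨γ, hγ, hx, h1, h2⟩ :=
    hβ.good.exists_isSub_below ha hb hab (pos_lt_of_not_lt (by omega) hc)
  have h3 := h γ (hγ.trans hβ) hx _ _ botRight_bot topLeft_top γ.bot_lt
  have h4 := hy _ _ h1 h2 γ.bot_lt
  omega

theorem below_of_above_imp {x y : SignedPerm n}
    (h : ∀ β : Arc n, β.IsSub α → β.Above y → β.Above x) (hβ : β.IsSub α) (hx : β.Below x) :
    β.Below y := by
  rw [← above_rev] at hx ⊢
  refine above_of_below_imp (α := α.rev) (fun γ hγ h1 => ?_) hβ.rev hx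
  have hγ' := hγ.rev
  rw [rev_rev] at hγ'
  have := h γ.rev hγ'
  rw [← below_rev, ← below_rev, rev_rev] at this
  exact this h1

/-- Signed permutations are related if the same subarcs of `α` are below them. -/
def subarcSetoid (α : Arc n) : Setoid (SignedPerm n) where
  r x y := ∀ β : Arc n, β.IsSub α → (β.Below x ↔ β.Below y)
  iseqv :=
    { refl := fun _ _ _ => Iff.rfl
      symm := fun h β hβ => (h β hβ).symm
      trans := fun h₁ h₂ β hβ => (h₁ β hβ).trans (h₂ β hβ) }

theorem subarcSetoid_iff {x y : SignedPerm n} :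
    α.subarcSetoid x y ↔ ∀ β : Arc n, β.IsSub α → (β.Below x ↔ β.Below y) := Iff.rfl

theorem subarcSetoid_iff_above {x y : SignedPerm n} :
    α.subarcSetoid x y ↔ ∀ β : Arc n, β.IsSub α → (β.Above x ↔ β.Above y) := by
  rw [subarcSetoid_iff]
  constructor
  · exact fun h β hβ => ⟨above_of_below_imp (fun γ hγ => (h γ hγ).mpr) hβ,
      above_of_below_imp (fun γ hγ => (h γ hγ).mp) hβ⟩
  · exact fun h β hβ => ⟨below_of_above_imp (fun γ hγ => (h γ hγ).mpr) hβ,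
      below_of_above_imp (fun γ hγ => (h γ hγ).mp) hβ⟩

/-- A principal filter contains a meet exactly when it contains both elements, and a principal ideal
treats joins in the same way. The two descriptions of the relation thus settle one operation each.
-/
theorem isCongruence_subarcSetoid (α : Arc n) : Forcing.IsCongruence α.subarcSetoid := by
  intro x₁ x₂ y₁ y₂ hx hy
  constructor
  · intro m₁ m₂ h₁ h₂
    rw [subarcSetoid_iff] at *
    have key : ∀ (x y m : SignedPerm n) (β : Arc n), β.IsSub α → IsGLB {x, y} m →
        (β.Below m ↔ β.Below x ∧ β.Below y) := by
      intro x y m β hβ hm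
      obtain ⟨j, hj⟩ := hβ.good.exists_le_iff
      rw [← hj, ← hj, ← hj, le_isGLB_iff hm, mem_lowerBounds]
      simp
    intro β hβ
    rw [key _ _ _ β hβ h₁, key _ _ _ β hβ h₂, hx β hβ, hy β hβ]
  · intro m₁ m₂ h₁ h₂
    rw [subarcSetoid_iff_above] at *
    have key : ∀ (x y m : SignedPerm n) (β : Arc n), β.IsSub α → IsLUB {x, y} m →
        (β.Above m ↔ β.Above x ∧ β.Above y) := by
      intro x y m β hβ hm
      obtain ⟨j, hj⟩ := hβ.good.exists_le_iff_above
      rw [← hj, ← hj, ← hj, isLUB_le_iff hm, mem_upperBounds]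
      simp
    intro β hβ
    rw [key _ _ _ β hβ h₁, key _ _ _ β hβ h₂, hx β hβ, hy β hβ]

/-! ### Join-irreducible elements contracted by the subarc congruence -/

theorem Adm.not_contracts_subarcSetoid (h : α.Adm) {j : SignedPerm n} (hj : α.IsJoinIrredOf j) :
    ¬Forcing.Contracts α.subarcSetoid j := by
  rintro ⟨y, hy, hΘ⟩
  have h1 := (hΘ α (Good.isSub_self (Or.inr h))).mp hj.below
  exact hy.not_ge ((h.le_iff_below hj).mpr h1)

theorem eq_or_eq_neg_of_isJoinIrredOf (hα : α.Adm) (hβ : β.Adm) {j : SignedPerm n}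
    (h₁ : α.IsJoinIrredOf j) (h₂ : β.IsJoinIrredOf j) : β = α ∨ β = -α := by
  have h3 : β ∈ arcDiagram j := hβ.mem_arcDiagram h₂
  rw [hα.arcDiagram_eq h₁] at h3
  exact h3

theorem Adm.lower_le (h : α.Adm) {j j' : SignedPerm n} (hj : α.IsJoinIrredOf j)
    (hj' : ∀ a b : Pt n, (a : ℤ) < b → (pos j' b < pos j' a ↔
      pos j b < pos j a ∧ ¬(a = α.bot ∧ b = α.top) ∧ ¬(a = -α.top ∧ b = -α.bot))) :
    j' < j ∧ ∀ z, z ≤ j → ¬j ≤ z → z ≤ j' := by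
  refine ⟨lt_of_le_not_ge (weak_le_iff.mpr fun a b hab h1 => ((hj' a b hab).mp h1).1) fun hc => ?_,
    fun z hz hz' => weak_le_iff.mpr fun a b hab h1 => ?_⟩
  · have h1 := weak_le_iff.mp hc _ _ α.bot_lt (hj.below _ _ botRight_bot topLeft_top α.bot_lt)
    exact ((hj' _ _ α.bot_lt).mp h1).2.1 ⟨rfl, rfl⟩
  · refine (hj' a b hab).mpr ⟨weak_le_iff.mp hz a b hab h1, ?_, ?_⟩
    · rintro ⟨rfl, rfl⟩
      exact hz' (h.le_of_pos_lt hj hz h1)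
    · rintro ⟨rfl, rfl⟩
      rw [pos_neg, pos_neg] at h1
      exact hz' (h.le_of_pos_lt hj hz (by omega))

/-- A join-irreducible element below `j` and different from `j` is below the lower cover `j'`, and
only `β` and `-β` represent `j`. So `j` and `j'` have the same subarcs of `α` below them. -/
theorem Adm.contracts_subarcSetoid (h : β.Adm) {j : SignedPerm n} (hj : β.IsJoinIrredOf j)
    (h1 : ¬β.IsSub α) (h2 : ¬(-β).IsSub α) : Forcing.Contracts α.subarcSetoid j := by
  obtain ⟨j', hj'⟩ := h.exists_lower hj
  obtain ⟨hlt, hmax⟩ := h.lower_le hj hj'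
  refine ⟨j', hlt, fun γ hγ => ⟨fun hγj => ?_, fun hγj => hγj.mono hlt.le⟩⟩
  have key : ∀ δ : Arc n, δ.Adm → δ.Below j → δ ≠ β → δ ≠ -β → δ.Below j' := by
    intro δ hδ hδj hne hne'
    obtain ⟨i, hi⟩ := hδ.exists_isJoinIrredOf
    have h3 : i ≤ j := (hδ.le_iff_below hi).mpr hδj
    refine (hδ.le_iff_below hi).mp (hmax i h3 fun h4 => ?_)
    rw [← weak_antisymm h4 h3] at hi
    rcases eq_or_eq_neg_of_isJoinIrredOf h hδ hj hi with h5 | h5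
    · exact hne h5
    · exact hne' h5
  have hne : γ ≠ β := fun e => h1 (e ▸ hγ)
  have hne' : γ ≠ -β := fun e => h2 (e ▸ hγ)
  rcases hγ.good.adm_or_neg with h3 | h3
  · exact key γ h3 hγj hne hne'
  · refine below_neg.mp (key (-γ) h3 (below_neg.mpr hγj) (fun e => hne' ?_) fun e => hne ?_)
    · rw [← e, neg_neg']
    · rw [← neg_neg' (α := γ), e, neg_neg']

end Arc

namespace Arc

variable {α β : Arc n} {Θ : Setoid (SignedPerm n)}

/-! ### Contracted arcs -/

/-- `Θ` relates elements below and above which `α` lies. For an arc of a join-irreducible element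
and a congruence `Θ`, this means that the element is contracted. -/
def Contracted (Θ : Setoid (SignedPerm n)) (α : Arc n) : Prop :=
  ∃ x y, x ≤ y ∧ Θ x y ∧ α.Below y ∧ α.Above x

theorem contracted_neg : Contracted Θ (-α) ↔ Contracted Θ α := by
  simp only [Contracted, below_neg, above_neg]

/-- The transport of an equivalence relation along `w ↦ w₀ w`. -/
def dual (Θ : Setoid (SignedPerm n)) : Setoid (SignedPerm n) :=
  Θ.comap fun w => longest n * w

theorem contracted_dual_rev : Contracted (dual Θ) α.rev ↔ Contracted Θ α := by
  constructor
  · rintro ⟨x, y, h1, h2, h3, h4⟩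
    refine ⟨longest n * y, longest n * x, longest_mul_le_longest_mul.mpr h1, Θ.symm' h2, ?_, ?_⟩
    · rw [← above_rev, longest_mul_longest_mul]; exact h4
    · rw [← below_rev, longest_mul_longest_mul]; exact h3
  · rintro ⟨x, y, h1, h2, h3, h4⟩
    refine ⟨longest n * y, longest n * x, longest_mul_le_longest_mul.mpr h1, ?_,
      below_rev.mpr h4, above_rev.mpr h3⟩
    change Θ (longest n * (longest n * y)) (longest n * (longest n * x))
    rw [longest_mul_longest_mul, longest_mul_longest_mul]
    exact Θ.symm' h2

theorem isCongruence_dual (hΘ : Forcing.IsCongruence Θ) : Forcing.IsCongruence (dual Θ) := by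
  intro x₁ x₂ y₁ y₂ hx hy
  obtain ⟨h1, h2⟩ := hΘ _ _ _ _ hx hy
  exact ⟨fun m₁ m₂ hm₁ hm₂ => h2 _ _ (isLUB_longest_mul hm₁) (isLUB_longest_mul hm₂),
    fun m₁ m₂ hm₁ hm₂ => h1 _ _ (isGLB_longest_mul hm₁) (isGLB_longest_mul hm₂)⟩

theorem isGLB_pair_of_le {x y : SignedPerm n} (h : x ≤ y) : IsGLB {x, y} x :=
  ⟨by rintro z (rfl | rfl); exacts [le_rfl, h], fun _ hz => hz (Set.mem_insert _ _)⟩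

theorem isLUB_pair_of_le {x y : SignedPerm n} (h : x ≤ y) : IsLUB {y, x} y :=
  ⟨by rintro z (rfl | rfl); exacts [le_rfl, h], fun _ hz => hz (Set.mem_insert _ _)⟩

/-- Meeting the related pair `x`, `y` with `j` relates `j ∧ y = j` to `j ∧ x`, which is strictly
smaller because `x` does not invert the endpoints of `α`. -/
theorem Adm.contracts_of_contracted (h : α.Adm) {j : SignedPerm n} (hj : α.IsJoinIrredOf j)
    (hΘ : Forcing.IsCongruence Θ) (hc : Contracted Θ α) : Forcing.Contracts Θ j := by
  obtain ⟨x, y, -, h2, h3, h4⟩ := hc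
  obtain ⟨m, hm⟩ := exists_isGLB j x
  have hjm : Θ j m := (hΘ j j y x (Θ.refl' j) (Θ.symm' h2)).1 _ _
    (isGLB_pair_of_le ((h.le_iff_below hj).mpr h3)) hm
  refine ⟨m, lt_of_le_not_ge (hm.1 (Set.mem_insert _ _)) fun hle => ?_, hjm⟩
  have h5 : m ≤ x := hm.1 (Set.mem_insert_of_mem _ rfl)
  have h6 := (h.le_iff_below hj).mp (hle.trans h5) _ _ botRight_bot topLeft_top α.bot_lt
  have h7 := h4 _ _ botLeft_bot topRight_top α.bot_lt
  omega

/-- If no pair that is inverted in `j`, except for the endpoints of `α` and of `-α`, is an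
obstruction to `β` being above `j`, then `β` is above the element covered by `j`. -/
theorem Adm.above_lower (h : α.Adm) {j : SignedPerm n} (hj : α.IsJoinIrredOf j)
    (hinv : ∀ a b, β.BotLeft a → β.TopRight b → (a : ℤ) < b → pos j b < pos j a →
      a = α.bot ∧ b = α.top ∨ a = -α.top ∧ b = -α.bot) :
    ∃ j', j' < j ∧ (∀ z, z ≤ j → ¬j ≤ z → z ≤ j') ∧ β.Above j' ∧
      (∀ a b : Pt n, (a : ℤ) < b → (pos j' b < pos j' a ↔
        pos j b < pos j a ∧ ¬(a = α.bot ∧ b = α.top) ∧ ¬(a = -α.top ∧ b = -α.bot))) := by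
  obtain ⟨j', hj'⟩ := h.exists_lower hj
  obtain ⟨hlt, hmax⟩ := h.lower_le hj hj'
  refine ⟨j', hlt, hmax, fun a b ha hb hab => ?_, hj'⟩
  by_contra hc
  have h1 := (hj' a b hab).mp (pos_lt_of_not_lt (by omega) hc)
  exact (hinv a b ha hb hab h1.1).elim h1.2.1 h1.2.2

/-! ### Inverted pairs of a join-irreducible element against a larger arc -/

theorem Adm.inv_of_bot_pos (h : α.Adm) (h0 : 0 < (α.bot : ℤ)) {j : SignedPerm n}
    (hj : α.IsJoinIrredOf j) {a b : Pt n} (hab : (a : ℤ) < b) (hlt : pos j b < pos j a) :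
    α.BotRight a ∧ α.TopLeft b ∨ α.BotRight (-b) ∧ α.TopLeft (-a) := by
  have key : ∀ a b : Pt n, (a : ℤ) < b → α.block a = 1 → α.block b ≤ 0 →
      α.BotRight a ∧ α.TopLeft b := by
    intro a b hab ha hb
    have hb1 : ¬α.Last b := fun h => by have := block_eq_one.mpr h; omega
    have hb2 : (b : ℤ) ≤ α.top := by
      by_contra hc
      refine hb1 (Or.inr ⟨by omega, fun h2 => ?_⟩)
      have := h2.bounds
      rw [Pt.coe_neg] at this
      have := α.bot_lt
      omega
    have ha' := (block_of_le_top (by omega)).mp ha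
    exact ⟨ha', topLeft_of_not_botRight (by have := ha'.bounds; omega) hb2 fun h => hb1 (Or.inl h)⟩
  rw [hj] at hlt
  have ha := block_cases (α := α) a
  have hb := block_cases (α := α) b
  by_cases h1 : α.block a = 1
  · exact Or.inl (key a b hab h1 (by omega))
  · exact Or.inr (key (-b) (-a) (by simp only [Pt.coe_neg]; omega)
      (by rw [h.block_neg]; omega) (by rw [h.block_neg]; omega))

theorem Good.not_topRight_neg (h : β.Good) {v : Pt n} (hv : v ∈ β.right) : ¬β.TopRight (-v) := by
  intro hv'
  rcases h with h | h
  · have h1 := right_bounds hv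
    have h2 := hv'.bounds
    unfold NonOverlapping at h
    rw [Pt.coe_neg] at h2
    omega
  · rcases hv' with hv' | hv'
    · rw [← Pt.neg_neg v, hv'] at hv
      exact h.neg_top hv
    · exact h.neg_right v hv hv'

/-- Pairs that are inverted in the join-irreducible element of a non-overlapping restriction of
`β` are not an obstruction to being below the meet-irreducible element of `β`, except for the
endpoints. -/
theorem NonOverlapping.inv_eq (hβ : β.Good) (hr : α.IsRestriction β)
    (hs : β.TopRight (-α.bot) → (β.bot : ℤ) = -β.top) {a b : Pt n}
    (ha : β.BotLeft a) (hb : β.TopRight b)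
    (h : α.BotRight a ∧ α.TopLeft b ∨ α.BotRight (-b) ∧ α.TopLeft (-a)) :
    a = α.bot ∧ b = α.top ∨ a = -α.top ∧ b = -α.bot := by
  obtain ⟨h1, h2, h3⟩ := hr
  have ha' := (botLeft_iff.mp ha).2.2
  have hright : ∀ v ∈ α.right, v ∈ β.right := fun v hv =>
    (h3 v (right_bounds hv).1 (right_bounds hv).2).mp hv
  have hleft : ∀ v ∈ α.left, v ∉ β.right := fun v hv hv' =>
    hv.2 ((h3 v (left_bounds hv).1 (left_bounds hv).2).mpr hv')
  rcases h with ⟨h4, h5⟩ | ⟨h4, h5⟩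
  · left
    constructor
    · exact h4.resolve_right fun h => ha' (hright a h)
    · refine h5.resolve_right fun h => ?_
      rcases hb with rfl | hb
      · have := left_bounds h; omega
      · exact hleft b h hb
  · right
    have h6 : -b = α.bot := by
      refine h4.resolve_right fun h => ?_
      have := hβ.not_topRight_neg (hright _ h)
      rw [Pt.neg_neg] at this
      exact this hb
    have h6' : b = -α.bot := by rw [← h6, Pt.neg_neg]
    refine ⟨?_, h6'⟩
    have hsym := hs (h6' ▸ hb)
    have h7 : -a = α.top := by
      refine h5.resolve_right fun h => ?_
      have hl := hleft _ h
      have hb' := left_bounds h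
      rw [Pt.coe_neg] at hb'
      rcases hβ with hβ | hβ
      · unfold NonOverlapping at hβ
        omega
      · rcases hβ.symm hsym a (by omega) (by omega) with h8 | h8
        · exact ha' h8
        · exact hl h8
    rw [← h7, Pt.neg_neg]

/-- The analogue of `NonOverlapping.inv_eq` for overlapping arcs. The danger is a pair with `b =
-α.bot`; `hs` together with the admissibility of `α` confines it to the case where it is the pair of
endpoints. -/
theorem Adm.inv_eq (h : α.Adm) (h0 : (α.bot : ℤ) < 0) (hβ : β.Adm) (hr : α.IsRestriction β)
    (hs : β.TopRight (-α.bot) → -(α.bot : ℤ) ≤ α.top) {j : SignedPerm n}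
    (hj : α.IsJoinIrredOf j) {a b : Pt n} (ha : β.BotLeft a) (hb : β.TopRight b)
    (hab : (a : ℤ) < b) (hlt : pos j b < pos j a) : a = α.bot ∧ b = α.top := by
  obtain ⟨h1, h2, h3⟩ := hr
  have ha' := (botLeft_iff.mp ha).2.2
  have hbt := α.bot_lt
  have hright : ∀ v ∈ α.right, v ∈ β.right := fun v hv =>
    (h3 v (right_bounds hv).1 (right_bounds hv).2).mp hv
  have hBR : α.BotRight (-b) → b = -α.bot := by
    rintro (h4 | h4)
    · rw [← h4, Pt.neg_neg]
    · have := Good.not_topRight_neg (Or.inr hβ) (hright _ h4)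
      rw [Pt.neg_neg] at this
      exact absurd hb this
  rw [hj] at hlt
  have hca := block_cases (α := α) a
  have hcb := block_cases (α := α) b
  by_cases hba : α.block a = 1
  · have hnb : ¬α.Last b := fun h => by have := block_eq_one.mpr h; omega
    have hbtop : (b : ℤ) ≤ α.top := by
      by_contra hc
      have h4 : α.BotRight (-b) := by
        by_contra h5
        exact hnb (Or.inr ⟨by omega, h5⟩)
      have h5 := hBR h4
      have h6 := hs (h5 ▸ hb)
      rw [h5, Pt.coe_neg] at hc
      omega
    have h4 := (block_of_le_top (by omega)).mp hba
    have h5 : a = α.bot := h4.resolve_right fun h => ha' (hright a h)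
    refine ⟨h5, Pt.ext' (le_antisymm hbtop ?_)⟩
    by_contra hc
    have h6 : b ∈ β.right := hb.resolve_left fun e => by
      rw [Pt.eq_iff] at e
      omega
    exact hnb (Or.inl (Or.inr ((h3 b (by rw [← h5]; exact hab) (by omega)).mpr h6)))
  · exfalso
    have hb0 : α.block b = -1 := by omega
    have ha0 : α.block a = 0 := by omega
    have hbd := h.bounds_of_block_eq_zero ha0
    rw [h.block_eq_neg_one] at hb0
    rcases hb0 with h4 | h4
    · have h5 := hBR h4
      have h6 := hs (h5 ▸ hb)
      have h7 : (α.bot : ℤ) ≠ -α.top := fun e => by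
        have := h.block_of_symm e a
        omega
      rw [h5] at hb
      rcases hb with h8 | h8
      · rw [Pt.neg_eq_iff] at h8
        omega
      · exact h.neg_bot ((h3 _ (by rw [Pt.coe_neg]; omega) (by rw [Pt.coe_neg]; omega)).mpr h8)
    · rw [Pt.coe_neg] at h4
      omega

/-- Inverted pairs of a join-irreducible element that represents `α` up to sign, for
non-overlapping `α`. -/
theorem NonOverlapping.exists_rep (h : α.NonOverlapping) :
    ∃ γ : Arc n, γ.Adm ∧ (γ = α ∨ γ = -α) ∧ ∀ j : SignedPerm n, γ.IsJoinIrredOf j →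
      ∀ a b : Pt n, (a : ℤ) < b → pos j b < pos j a →
        α.BotRight a ∧ α.TopLeft b ∨ α.BotRight (-b) ∧ α.TopLeft (-a) := by
  rcases h with h | h
  · exact ⟨α, adm_of_bot_pos h, Or.inl rfl, fun j hj a b =>
      (adm_of_bot_pos h).inv_of_bot_pos h hj⟩
  · have h' : 0 < ((-α).bot : ℤ) := by rw [Arc.neg_bot, Pt.coe_neg]; omega
    refine ⟨-α, adm_of_bot_pos h', Or.inr rfl, fun j hj a b hab hlt => ?_⟩
    have := (adm_of_bot_pos h').inv_of_bot_pos h' hj hab hlt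
    rw [botRight_neg, botRight_neg, topLeft_neg, topLeft_neg, Pt.neg_neg, Pt.neg_neg] at this
    tauto

theorem NonOverlapping.not_topRight_neg_bot (h : α.NonOverlapping) : ¬α.TopRight (-α.bot) := by
  intro h1
  have h2 := h1.bounds
  unfold NonOverlapping at h
  have := α.bot_lt
  rw [Pt.coe_neg] at h2
  omega

/-- All pairs that are inverted in the join-irreducible element of `α`, except for the endpoints,
are inverted in the meet-irreducible element of `α`. -/
theorem Good.inverted_of_le_iff_above (h : α.Good) {m : SignedPerm n}
    (hm : ∀ w, w ≤ m ↔ α.Above w) {a b : Pt n} (ha : α.BotRight a) (hb : α.TopLeft b)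
    (hab : (a : ℤ) < b) : a = α.bot ∧ b = α.top ∨ pos m b < pos m a := by
  -- The lower cover of the join-irreducible element satisfies `Above`, hence lies below `m`. It
  -- inverts all required pairs but the endpoints and their negatives.
  have key : ∀ γ : Arc n, γ.Adm → (γ = α ∨ γ = -α) → ∀ j : SignedPerm n, γ.IsJoinIrredOf j →
      (∀ a b, α.BotLeft a → α.TopRight b → (a : ℤ) < b → pos j b < pos j a →
        a = γ.bot ∧ b = γ.top ∨ a = -γ.top ∧ b = -γ.bot) →
      (a = α.bot ∧ b = α.top ∨ a = -α.top ∧ b = -α.bot) ∨ pos m b < pos m a := by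
    intro γ hγ hγα j hj hinv
    obtain ⟨j', -, -, h1, h2⟩ := hγ.above_lower hj hinv
    have h3 : α.Below j := by
      rcases hγα with rfl | rfl
      · exact hj.below
      · exact below_neg.mp hj.below
    by_cases h4 : a = γ.bot ∧ b = γ.top ∨ a = -γ.top ∧ b = -γ.bot
    · left
      rcases hγα with rfl | rfl
      · exact h4
      · rw [Arc.neg_top, Arc.neg_bot, Pt.neg_neg, Pt.neg_neg] at h4
        exact h4.symm
    · right
      push Not at h4
      exact weak_le_iff.mp ((hm j').mpr h1) a b hab
        ((h2 a b hab).mpr ⟨h3 a b ha hb hab, fun h => h4.1 h.1 h.2, fun h => h4.2 h.1 h.2⟩)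
  have key2 : (a = α.bot ∧ b = α.top ∨ a = -α.top ∧ b = -α.bot) ∨ pos m b < pos m a := by
    by_cases hno : α.NonOverlapping
    · obtain ⟨γ, hγ, hγα, hinv⟩ := hno.exists_rep
      obtain ⟨j, hj⟩ := hγ.exists_isJoinIrredOf
      refine key γ hγ hγα j hj fun x y hx hy hxy hlt => ?_
      have := NonOverlapping.inv_eq h (.refl α) (fun h1 => absurd h1 hno.not_topRight_neg_bot)
        hx hy (hinv j hj x y hxy hlt)
      rcases hγα with rfl | rfl
      · exact this
      · rw [Arc.neg_top, Arc.neg_bot, Pt.neg_neg, Pt.neg_neg]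
        exact this.symm
    · have hA := h.resolve_left hno
      obtain ⟨j, hj⟩ := hA.exists_isJoinIrredOf
      refine key α hA (Or.inl rfl) j hj fun x y hx hy hxy hlt => Or.inl ?_
      refine hA.inv_eq ?_ hA (.refl α) (fun h1 => ?_) hj hx hy hxy hlt
      · have := α.bot_neg_or_pos
        unfold NonOverlapping at hno
        omega
      · rcases h1 with h1 | h1
        · rw [Pt.neg_eq_iff] at h1
          omega
        · exact absurd h1 hA.neg_bot
  rcases key2 with (h1 | ⟨rfl, rfl⟩) | h1
  · exact Or.inl h1
  · left
    have h2 := ha.bounds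
    have h3 := α.bot_lt
    rw [Pt.coe_neg] at h2
    have hA : α.Adm := by
      refine h.resolve_left fun h4 => ?_
      unfold NonOverlapping at h4
      omega
    have h4 : -α.top = α.bot := ha.resolve_right hA.neg_top
    exact ⟨h4, by rw [← h4, Pt.neg_neg]⟩
  · exact Or.inr h1

/-! ### Contraction propagates along arrows -/

/-- The hypothesis `hinv` puts the lower cover `j'` below the greatest element `m` of the ideal of
`β`, while the inverted pair `x`, `y` keeps `j` out of that ideal. Joining `j ≡ j'` with `m` gives
`m ∨ j ≡ m`. -/
theorem Contracted.step (hΘ : Forcing.IsCongruence Θ) (h : α.Adm) {j : SignedPerm n}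
    (hj : α.IsJoinIrredOf j) (hβ : β.Good)
    (hinv : ∀ a b, β.BotLeft a → β.TopRight b → (a : ℤ) < b → pos j b < pos j a →
      a = α.bot ∧ b = α.top ∨ a = -α.top ∧ b = -α.bot)
    {x y : Pt n} (hx : β.BotLeft x) (hy : β.TopRight y) (hxy : (x : ℤ) < y)
    (hlt : pos j y < pos j x) (hc : Contracted Θ α) : Contracted Θ β := by
  obtain ⟨z, hz, hjz⟩ := h.contracts_of_contracted hj hΘ hc
  obtain ⟨j', hlt', hmax, habove, -⟩ := h.above_lower hj hinv
  obtain ⟨m, hm⟩ := hβ.exists_le_iff_above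
  have hjm : j' ≤ m := (hm j').mpr habove
  have hjj' : Θ j j' :=
    (hΘ j z j' j' hjz (Θ.refl' j')).2 _ _ (isLUB_pair_of_le hlt'.le) (by
      rw [Set.pair_comm]
      exact isLUB_pair_of_le (hmax z hz.le hz.not_ge))
  obtain ⟨u, hu⟩ := exists_isLUB m j
  have hmu : m ≤ u := hu.1 (Set.mem_insert _ _)
  have hju : j ≤ u := hu.1 (Set.mem_insert_of_mem _ rfl)
  have hum : Θ u m :=
    (hΘ m m j j' (Θ.refl' m) hjj').2 _ _ hu (isLUB_pair_of_le hjm)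
  have hmA : β.Above m := (hm m).mp le_rfl
  refine ⟨m, u, hmu, Θ.symm' hum, ?_, hmA⟩
  have hu' := weak_le_iff.mp hmu
  have h1 := weak_le_iff.mp hju x y hxy hlt
  -- Only the endpoints of `β` may fail to be inverted in `m`. In `u`, the top precedes or equals
  -- `y`, which precedes `x`, which precedes or equals the bottom.
  have hend : pos u β.top < pos u β.bot := by
    have h2 : pos u x ≤ pos u β.bot := by
      rcases hx with rfl | hx
      · exact le_rfl
      · have h3 := left_bounds hx
        rcases hβ.inverted_of_le_iff_above hm botRight_bot (Or.inr hx) h3.1 with h4 | h4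
        · rw [h4.2] at h3
          omega
        · exact (hu' _ _ h3.1 h4).le
    have h3 : pos u β.top ≤ pos u y := by
      rcases hy with rfl | hy
      · exact le_rfl
      · have h3 := right_bounds hy
        rcases hβ.inverted_of_le_iff_above hm (Or.inr hy) topLeft_top h3.2 with h4 | h4
        · rw [h4.1] at h3
          omega
        · exact (hu' _ _ h3.2 h4).le
    omega
  intro a b ha hb hab
  rcases hβ.inverted_of_le_iff_above hm ha hb hab with ⟨rfl, rfl⟩ | h2
  · exact hend
  · exact hu' a b hab h2

/-- A single arrow: `hx` and `hy` make the endpoints of `α` a violation of `Above β`. The condition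
`hs` ensures that a violating pair arising from the negative arc can only be the negative of the
pair of endpoints. -/
theorem Contracted.of_nonOverlapping (hΘ : Forcing.IsCongruence Θ) (h : α.NonOverlapping)
    (hβ : β.Good) (hr : α.IsRestriction β) (hx : β.BotLeft α.bot) (hy : β.TopRight α.top)
    (hs : β.TopRight (-α.bot) → (β.bot : ℤ) = -β.top) (hc : Contracted Θ α) :
    Contracted Θ β := by
  obtain ⟨γ, hγ, hγα, hinv⟩ := h.exists_rep
  obtain ⟨j, hj⟩ := hγ.exists_isJoinIrredOf
  have hb : α.Below j := by
    rcases hγα with rfl | rfl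
    · exact hj.below
    · exact below_neg.mp hj.below
  have hc' : Contracted Θ γ := by
    rcases hγα with rfl | rfl
    · exact hc
    · exact contracted_neg.mpr hc
  refine hc'.step hΘ hγ hj hβ (fun a b ha hb hab hlt => ?_) hx hy α.bot_lt
    (hb _ _ botRight_bot topLeft_top α.bot_lt)
  have := NonOverlapping.inv_eq hβ hr hs ha hb (hinv j hj a b hab hlt)
  rcases hγα with rfl | rfl
  · exact this
  · rw [Arc.neg_top, Arc.neg_bot, Pt.neg_neg, Pt.neg_neg]
    exact this.symm

theorem Contracted.of_overlapping (hΘ : Forcing.IsCongruence Θ) (h : α.Adm)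
    (h0 : (α.bot : ℤ) < 0) (hβ : β.Adm) (hr : α.IsRestriction β) (hx : β.BotLeft α.bot)
    (hy : β.TopRight α.top) (hs : β.TopRight (-α.bot) → -(α.bot : ℤ) ≤ α.top)
    (hc : Contracted Θ α) : Contracted Θ β := by
  obtain ⟨j, hj⟩ := h.exists_isJoinIrredOf
  exact hc.step hΘ h hj (Or.inr hβ)
    (fun a b ha hb hab hlt => Or.inl (h.inv_eq h0 hβ hr hs hj ha hb hab hlt)) hx hy α.bot_lt
    (hj.below _ _ botRight_bot topLeft_top α.bot_lt)

theorem Contracted.of_nonOverlapping' (hΘ : Forcing.IsCongruence Θ) (h : α.NonOverlapping)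
    (hβ : β.Good) (hr : α.IsRestriction β) (hx : β.BotRight α.bot) (hy : β.TopLeft α.top)
    (hs : β.BotRight (-α.top) → (β.bot : ℤ) = -β.top) (hc : Contracted Θ α) :
    Contracted Θ β := by
  rw [← contracted_dual_rev] at hc ⊢
  refine hc.of_nonOverlapping (isCongruence_dual hΘ) h.rev hβ.rev hr.rev ?_ ?_ ?_
  · rwa [rev_bot, botLeft_rev, Pt.neg_neg]
  · rwa [rev_top, topRight_rev, Pt.neg_neg]
  · rw [rev_bot, rev_bot, rev_top, topRight_rev, Pt.neg_neg, Pt.coe_neg, Pt.coe_neg]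
    intro h1
    have := hs h1
    omega

theorem Contracted.of_overlapping' (hΘ : Forcing.IsCongruence Θ) (h : α.Adm)
    (h0 : (α.bot : ℤ) < 0) (hβ : β.Adm) (hr : α.IsRestriction β) (hx : β.BotRight α.bot)
    (hy : β.TopLeft α.top) (hs : β.BotRight (-α.top) → (α.bot : ℤ) ≤ -α.top)
    (hc : Contracted Θ α) : Contracted Θ β := by
  have h1 := hr.1
  have := h.top_pos
  rw [← contracted_dual_rev] at hc ⊢
  refine hc.of_overlapping (isCongruence_dual hΘ) (h.rev h0) ?_ (hβ.rev (by omega)) hr.rev ?_ ?_ ?_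
  · rw [rev_bot, Pt.coe_neg]; omega
  · rwa [rev_bot, botLeft_rev, Pt.neg_neg]
  · rwa [rev_top, topRight_rev, Pt.neg_neg]
  · rw [rev_bot, rev_top, topRight_rev, Pt.neg_neg, Pt.coe_neg, Pt.coe_neg]
    intro h2
    have := hs h2
    omega

/-! ### Subarcs force -/

theorem IsRestriction.trans_restrict_top (hr : α.IsRestriction β)
    {hab : (α.bot : ℤ) < β.top} : α.IsRestriction (β.restrict α.bot β.top hab) :=
  hr.restrict le_rfl hr.2.1

theorem Contracted.extend_top (hΘ : Forcing.IsCongruence Θ) (h : 0 < (α.bot : ℤ))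
    (hr : α.IsRestriction β) {hab : (α.bot : ℤ) < β.top} (hc : Contracted Θ α) :
    Contracted Θ (β.restrict α.bot β.top hab) := by
  have hbt := α.bot_lt
  have hr2 := hr.2.1
  by_cases h1 : β.TopRight α.top
  · refine hc.of_nonOverlapping hΘ (Or.inl h) (Or.inl (Or.inl h)) hr.trans_restrict_top
      botLeft_bot ?_ fun h2 => ?_
    · rcases h1 with h1 | h1
      · exact Or.inl h1
      · exact Or.inr ⟨h1, hbt, (right_bounds h1).2⟩
    · exact absurd h2 (NonOverlapping.not_topRight_neg_bot
        (α := β.restrict α.bot β.top hab) (Or.inl h))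
  · refine hc.of_nonOverlapping' hΘ (Or.inl h) (Or.inl (Or.inl h)) hr.trans_restrict_top
      botRight_bot ?_ fun h2 => ?_
    · rw [topLeft_restrict]
      refine (eq_or_ne α.top β.top).imp id fun h2 => ⟨fun h3 => h1 (Or.inr h3), hbt, ?_⟩
      have := Pt.eq_iff.not.mp h2
      omega
    · have := h2.bounds
      rw [restrict_bot, Pt.coe_neg] at this
      omega

/-- Raise the top end first, then lower the bottom end. The hypothesis `hn` keeps the intermediate
arc admissible and not symmetric. -/
theorem Contracted.of_overlapping_of_not_symm_aux (hΘ : Forcing.IsCongruence Θ) (h : α.Adm)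
    (h0 : (α.bot : ℤ) < 0) (hβ : β.Adm) (hs : (β.bot : ℤ) ≠ -β.top) (hr : α.IsRestriction β)
    (hn : ¬β.TopRight (-α.bot)) (hc : Contracted Θ α) : Contracted Θ β := by
  have hbt := α.bot_lt
  have hr1 := hr.1
  have hr2 := hr.2.1
  have htop := h.top_pos
  have hab : (α.bot : ℤ) < β.top := by omega
  have hγ : (β.restrict α.bot β.top hab).Adm :=
    { top_pos := hβ.top_pos
      neg_right := fun v hv hv' => hβ.neg_right v hv.1 hv'.1
      neg_bot := fun h1 => hn (Or.inr h1.1)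
      neg_top := fun h1 => hβ.neg_top h1.1
      symm := fun h1 => absurd (Or.inl (Pt.ext' (by
        rw [restrict_bot, restrict_top] at h1
        rw [Pt.coe_neg]
        omega))) hn }
  have h1 : Contracted Θ (β.restrict α.bot β.top hab) := by
    by_cases h1 : β.TopRight α.top
    · refine hc.of_overlapping hΘ h h0 hγ hr.trans_restrict_top botLeft_bot ?_ fun h2 => ?_
      · rcases h1 with h1 | h1
        · exact Or.inl h1
        · exact Or.inr ⟨h1, hbt, (right_bounds h1).2⟩
      · exact absurd (h2.imp id fun h3 => h3.1) hn
    · refine hc.of_overlapping' hΘ h h0 hγ hr.trans_restrict_top botRight_bot ?_ fun h2 => ?_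
      · rw [topLeft_restrict]
        refine (eq_or_ne α.top β.top).imp id fun h2 => ⟨fun h3 => h1 (Or.inr h3), hbt, ?_⟩
        have := Pt.eq_iff.not.mp h2
        omega
      · have := h2.bounds.1
        rwa [restrict_bot, Pt.coe_neg] at this
  have hr' : (β.restrict α.bot β.top hab).IsRestriction β := isRestriction_restrict hr1 le_rfl
  by_cases h2 : α.bot ∈ β.right
  · refine h1.of_overlapping' hΘ hγ h0 hβ hr' (Or.inr h2) topLeft_top fun h3 => ?_
    rw [restrict_top] at h3
    rcases h3 with h3 | h3
    · rw [Pt.neg_eq_iff] at h3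
      omega
    · exact absurd h3 hβ.neg_top
  · exact h1.of_overlapping hΘ hγ h0 hβ hr' (botLeft_iff.mpr ⟨hr1, hab, h2⟩) topRight_top
      fun h3 => absurd h3 hn

/-- Either `hn` of the auxiliary lemma or its mirror image holds. If both failed, the shorter of the
two ends of `α` would reflect to an inner point contradicting the admissibility of `α`, or the ends
would be opposite, against the admissibility or asymmetry of `β`. -/
theorem Contracted.of_overlapping_of_not_symm (hΘ : Forcing.IsCongruence Θ) (h : α.Adm)
    (h0 : (α.bot : ℤ) < 0) (hβ : β.Adm) (hs : (β.bot : ℤ) ≠ -β.top) (hr : α.IsRestriction β)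
    (hc : Contracted Θ α) : Contracted Θ β := by
  have htop := h.top_pos
  have hr1 := hr.1
  have hr2 := hr.2.1
  by_cases hn : β.TopRight (-α.bot)
  · have hn' : ¬β.BotRight (-α.top) := by
      intro hn'
      have e1 := Pt.coe_neg α.bot
      have e2 := Pt.coe_neg α.top
      rcases lt_trichotomy (-(α.bot : ℤ)) α.top with h1 | h1 | h1
      · rcases hn with hn | hn
        · rw [Pt.eq_iff] at hn
          omega
        · exact h.neg_bot ((hr.2.2 _ (by omega) (by omega)).mpr hn)
      · have h2 : -α.bot = α.top := Pt.ext' h1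
        rw [h2] at hn
        rcases hn' with h3 | h3
        · rcases hn with h4 | h4
          · rw [← h3, ← h4, Pt.coe_neg] at hs
            exact hs rfl
          · rw [← Pt.neg_neg α.top, h3] at h4
            exact hβ.neg_bot h4
        · exact Good.not_topRight_neg (Or.inr hβ) h3 (by rwa [Pt.neg_neg])
      · rcases hn' with hn' | hn'
        · rw [Pt.eq_iff] at hn'
          omega
        · exact h.neg_top ((hr.2.2 _ (by omega) (by omega)).mpr hn')
    rw [← contracted_dual_rev] at hc ⊢
    refine hc.of_overlapping_of_not_symm_aux (isCongruence_dual hΘ) (h.rev h0) ?_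
      (hβ.rev (by omega)) ?_ hr.rev ?_
    · rw [rev_bot, Pt.coe_neg]; omega
    · rw [rev_bot, rev_top, Pt.coe_neg, Pt.coe_neg]
      omega
    · rwa [rev_bot, topRight_rev, Pt.neg_neg]
  · exact hc.of_overlapping_of_not_symm_aux hΘ h h0 hβ hs hr hn

/-- Both ends move in one arrow, since the intermediate arcs would not be symmetric. By symmetry the
two ends of `α` are on opposite sides of `β` unless they are its endpoints, so the arrow or its dual
is available. -/
theorem Contracted.of_symm (hΘ : Forcing.IsCongruence Θ) (h : α.Adm)
    (hα : (α.bot : ℤ) = -α.top) (hβ : β.Adm) (hs : (β.bot : ℤ) = -β.top)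
    (hr : α.IsRestriction β) (hc : Contracted Θ α) : Contracted Θ β := by
  have htop := h.top_pos
  have hr1 := hr.1
  have hr2 := hr.2.1
  have h1 : α.bot = -α.top := Pt.ext' hα
  by_cases h2 : β.TopRight α.top
  · refine hc.of_overlapping hΘ h (by omega) hβ hr (botLeft_iff.mpr ⟨hr1, by omega, ?_⟩) h2
      fun _ => by omega
    rw [h1]
    rcases h2 with h2 | h2
    · rw [h2]; exact hβ.neg_top
    · exact hβ.neg_right _ h2
  · have h3 : α.top ∉ β.right := fun h3 => h2 (Or.inr h3)
    have h4 : (α.top : ℤ) ≠ β.top := fun h4 => h2 (Or.inl (Pt.ext' h4))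
    refine hc.of_overlapping' hΘ h (by omega) hβ hr ?_ (topLeft_iff.mpr ⟨by omega, hr2, h3⟩)
      fun _ => hα.le
    rw [h1]
    exact Or.inr ((hβ.symm hs α.top (by omega) (by omega)).resolve_left h3)

theorem Contracted.of_bot_pos (hΘ : Forcing.IsCongruence Θ) (h : 0 < (α.bot : ℤ)) (hβ : β.Adm)
    (hr : α.IsRestriction β) (hc : Contracted Θ α) : Contracted Θ β := by
  have hbt := α.bot_lt
  have hr1 := hr.1
  have hr2 := hr.2.1
  have hab : (α.bot : ℤ) < β.top := by omega
  have h1 : Contracted Θ (β.restrict α.bot β.top hab) := hc.extend_top hΘ h hr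
  have hr' : (β.restrict α.bot β.top hab).IsRestriction β := isRestriction_restrict hr1 le_rfl
  have hno : (β.restrict α.bot β.top hab).NonOverlapping := Or.inl h
  by_cases h2 : α.bot ∈ β.right
  · refine h1.of_nonOverlapping' hΘ hno (Or.inr hβ) hr' (Or.inr h2) topLeft_top fun h3 => ?_
    rw [restrict_top] at h3
    rcases h3 with h3 | h3
    · rw [← h3, Pt.coe_neg]
    · exact absurd h3 hβ.neg_top
  · have h3 : β.BotLeft α.bot := botLeft_iff.mpr ⟨hr1, hab, h2⟩
    by_cases h4 : β.TopRight (-α.bot) → (β.bot : ℤ) = -β.top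
    · exact h1.of_nonOverlapping hΘ hno (Or.inr hβ) hr' h3 topRight_top h4
    · push Not at h4
      obtain ⟨h4, h5⟩ := h4
      have h6 : -α.bot ∈ β.right := h4.resolve_left fun h6 => by
        rw [Pt.neg_eq_iff] at h6
        have := hβ.top_pos
        omega
      have e := Pt.coe_neg α.bot
      have h7 := right_bounds h6
      have hab' : ((-α.bot : Pt n) : ℤ) < β.top := h7.2
      have hδ : (β.restrict (-α.bot) β.top hab').Adm :=
        { top_pos := hβ.top_pos
          neg_right := fun v hv hv' => hβ.neg_right v hv.1 hv'.1
          neg_bot := fun h1 => by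
            rw [restrict_bot, Pt.neg_neg] at h1
            exact h2 h1.1
          neg_top := fun h1 => hβ.neg_top h1.1
          symm := fun h1 => by
            rw [restrict_bot, restrict_top] at h1
            omega }
      -- The direct arrow to `β` is blocked by the right point `-α.bot`. The detour stops with the
      -- bottom end at `-α.bot`, where this point is an endpoint and no longer an obstruction.
      have h8 : Contracted Θ (β.restrict (-α.bot) β.top hab') := by
        refine h1.of_nonOverlapping hΘ hno (Or.inr hδ)
          (hr'.restrict (by rw [restrict_bot]; omega) le_rfl)
          (botLeft_iff.mpr ⟨?_, hab, fun h9 => h2 h9.1⟩) topRight_top fun h9 => ?_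
        · rw [restrict_bot, restrict_bot]; omega
        · have := h9.bounds
          rw [restrict_bot, restrict_bot] at this
          omega
      refine h8.of_overlapping_of_not_symm hΘ hδ ?_ hβ h5 (isRestriction_restrict h7.1.le le_rfl)
      rw [restrict_bot]
      omega

theorem Contracted.of_isSub (hΘ : Forcing.IsCongruence Θ) (hβ : β.Adm) (h : α.IsSub β)
    (hc : Contracted Θ α) : Contracted Θ β := by
  rcases h.2 with (h1 | h1) | h1
  · exact hc.of_bot_pos hΘ h1 hβ h.1
  · have := h.1.1
    have := α.bot_lt
    rw [← contracted_dual_rev] at hc ⊢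
    refine hc.of_bot_pos (isCongruence_dual hΘ) ?_ (hβ.rev (by omega)) h.1.rev
    rw [rev_bot, Pt.coe_neg]
    omega
  · rcases α.bot_neg_or_pos with h2 | h2
    · by_cases h3 : (β.bot : ℤ) = -β.top
      · exact hc.of_symm hΘ h1.1 (h1.2 h3) hβ h3 h.1
      · exact hc.of_overlapping_of_not_symm hΘ h1.1 h2 hβ h3 h.1
    · exact hc.of_bot_pos hΘ h2 hβ h.1

/-- Anything strictly below `j` lies below its lower cover, which satisfies `Above α`. -/
theorem Adm.contracted_of_contracts (h : α.Adm) {j : SignedPerm n} (hj : α.IsJoinIrredOf j)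
    (hc : Forcing.Contracts Θ j) : Contracted Θ α := by
  obtain ⟨z, hz, hjz⟩ := hc
  refine ⟨z, j, hz.le, Θ.symm' hjz, hj.below, fun a b ha hb hab => ?_⟩
  by_contra hc
  have hlt := pos_lt_of_not_lt (by omega) hc
  obtain ⟨j', -, hmax, habove, -⟩ := h.above_lower (β := α) hj (fun x y hx hy hxy hlt' => by
    rcases α.bot_neg_or_pos with h0 | h0
    · refine Or.inl (h.inv_eq h0 h (.refl α) (fun h1 => ?_) hj hx hy hxy hlt')
      rcases h1 with h1 | h1
      · rw [Pt.neg_eq_iff] at h1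
        omega
      · exact absurd h1 h.neg_bot
    · exact NonOverlapping.inv_eq (Or.inr h) (.refl α)
        (fun h1 => absurd h1 (NonOverlapping.not_topRight_neg_bot (Or.inl h0))) hx hy
        (h.inv_of_bot_pos h0 hj hxy hlt'))
  have := weak_le_iff.mp (hmax z hz.le hz.not_ge) a b hab hlt
  have := habove a b ha hb hab
  omega

/-- The join-irreducible element of `α` forces that of `β` if and only if `α` or `-α` is a
subarc of `β`. -/
theorem Adm.forces_iff (hα : α.Adm) (hβ : β.Adm) {j₁ j₂ : SignedPerm n}
    (h₁ : α.IsJoinIrredOf j₁) (h₂ : β.IsJoinIrredOf j₂) :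
    Forcing.Forces j₁ j₂ ↔ α.IsSub β ∨ (-α).IsSub β := by
  constructor
  · intro h
    by_contra hc
    push Not at hc
    exact hβ.not_contracts_subarcSetoid h₂
      (h _ (isCongruence_subarcSetoid β) (hα.contracts_subarcSetoid h₁ hc.1 hc.2))
  · intro h Θ hΘ hc
    have h1 := hα.contracted_of_contracts h₁ hc
    refine hβ.contracts_of_contracted h₂ hΘ ?_
    rcases h with h | h
    · exact h1.of_isSub hΘ hβ h
    · exact (contracted_neg.mpr h1).of_isSub hΘ hβ h

end Arc

namespace Arc

variable {α β γ : Arc n}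

/-! ### Comparison with subarcs and subarc pairs -/

theorem IsSymm.bot_eq (h : α.IsSymm) : (α.bot : ℤ) = -α.top := by
  have h1 : (-α).bot = α.bot := by rw [h]
  rw [Arc.neg_bot] at h1
  rw [← h1, Pt.coe_neg]

theorem Adm.isSymm (h : α.Adm) (hs : (α.bot : ℤ) = -α.top) : α.IsSymm := by
  refine Arc.ext (Pt.ext' ?_) (Pt.ext' ?_) (Set.ext fun v => ?_)
  · rw [Arc.neg_bot, Pt.coe_neg, hs]
  · rw [Arc.neg_top, Pt.coe_neg, hs]
    omega
  · rw [mem_neg_right, mem_left, Pt.coe_neg]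
    constructor
    · rintro ⟨h1, h2⟩
      exact (h.symm hs v (by omega) (by omega)).resolve_right h2
    · intro hv
      have := right_bounds hv
      exact ⟨by omega, h.neg_right v hv⟩

theorem IsSymm.adm (h : α.IsSymm) : α.Adm := by
  have hs := h.bot_eq
  have hbt := α.bot_lt
  have hr : ∀ v, v ∈ α.right ↔ -v ∈ α.left := fun v => by
    conv_lhs => rw [← h]
    exact mem_neg_right
  have e1 : -α.bot = α.top := Pt.ext' (by rw [Pt.coe_neg]; omega)
  have e2 : -α.top = α.bot := Pt.ext' (by rw [Pt.coe_neg]; omega)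
  refine ⟨by omega, fun v hv hv' => ((hr v).mp hv).2 hv', ?_, ?_, fun _ v h1 h2 => ?_⟩
  · rw [e1]; exact top_notMem
  · rw [e2]; exact bot_notMem
  · by_contra hc
    push Not at hc
    exact hc.1 ((hr v).mpr ⟨⟨by rw [Pt.lt_iff, Pt.coe_neg]; omega,
      by rw [Pt.lt_iff, Pt.coe_neg]; omega⟩, hc.2⟩)

theorem mem_Icc_neg {v : Pt n} :
    v ∈ Set.Icc (-α).bot (-α).top ↔ (α.bot : ℤ) ≤ -(v : ℤ) ∧ -(v : ℤ) ≤ α.top := by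
  rw [Set.mem_Icc, Pt.le_iff, Pt.le_iff, Arc.neg_bot, Arc.neg_top, Pt.coe_neg, Pt.coe_neg]
  omega

theorem Adm.isRightOf_neg (h : α.Adm) : IsRightOf α (-α) := by
  intro v hv hv'
  rw [mem_Icc_neg] at hv'
  have hle : (-α).side v ≤ 1 := by unfold side; split_ifs <;> omega
  by_cases h1 : v ∈ α.right
  · have h2 : v ∈ (-α).right := by
      rw [mem_neg_right, mem_left, Pt.coe_neg]
      refine ⟨⟨lt_of_le_of_ne hv'.1 fun e => ?_, lt_of_le_of_ne hv'.2 fun e => ?_⟩,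
        h.neg_right v h1⟩
      · refine h.neg_bot ?_
        have : -α.bot = v := Pt.ext' (by rw [Pt.coe_neg]; omega)
        rwa [this]
      · refine h.neg_top ?_
        have : -α.top = v := Pt.ext' (by rw [Pt.coe_neg]; omega)
        rwa [this]
    simp [side, h1, h2]
  · by_cases h2 : v ∈ α.left
    · have h3 : α.side v = 1 := by simp [side, h1, h2]
      omega
    · have h3 : α.side v = 0 := by simp [side, h1, h2]
      have h4 : v ∉ (-α).left := by
        rw [mem_neg_left]
        intro h4
        have h5 : v = α.bot ∨ v = α.top := by
          have h6 : ¬((α.bot : ℤ) < v ∧ (v : ℤ) < α.top) := fun h6 => h2 ⟨h6, h1⟩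
          obtain ⟨h7, h8⟩ := hv
          rw [Pt.le_iff] at h7 h8
          rw [Pt.eq_iff, Pt.eq_iff]
          omega
        rcases h5 with rfl | rfl
        · exact h.neg_bot h4
        · exact h.neg_top h4
      rw [h3]
      unfold side
      split_ifs <;> omega

theorem Adm.isPair (h : α.Adm) (hs : (α.bot : ℤ) ≠ -α.top) : α.IsPair := by
  refine ⟨fun e => hs ?_, fun e => hs ?_, Or.inl h.isRightOf_neg⟩
  · rw [Arc.neg_top, Pt.eq_iff, Pt.coe_neg] at e
    omega
  · rw [Arc.neg_bot, Pt.eq_iff, Pt.coe_neg] at e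
    exact e

theorem NonOverlapping.isPair (h : α.NonOverlapping) : α.IsPair := by
  have hbt := α.bot_lt
  unfold NonOverlapping at h
  refine ⟨fun e => ?_, fun e => ?_, Or.inl fun v hv hv' => ?_⟩
  · rw [Arc.neg_top, Pt.eq_iff, Pt.coe_neg] at e
    omega
  · rw [Arc.neg_bot, Pt.eq_iff, Pt.coe_neg] at e
    omega
  · rw [mem_Icc_neg] at hv'
    rw [Set.mem_Icc, Pt.le_iff, Pt.le_iff] at hv
    omega

theorem IsPair.bot_ne (h : α.IsPair) : (α.bot : ℤ) ≠ -α.top := fun e =>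
  h.2.1 (by rw [Arc.neg_bot, Pt.eq_iff, Pt.coe_neg]; exact e)

/-- With `Adm.isRightOf_neg` this identifies admissibility of an overlapping pair with `α` being the
right arc: a right point of `α` at a height that `-α` reaches must also be right of `-α`. -/
theorem IsRightOf.adm (h : IsRightOf α (-α)) (ho : α.IsOverlapping) (hp : α.IsPair) :
    α.Adm := by
  have hbt := α.bot_lt
  have key : ∀ v ∈ α.right, -v ∈ α.left ∨ ¬((α.bot : ℤ) ≤ -(v : ℤ) ∧ -(v : ℤ) ≤ α.top) := by
    intro v hv
    by_cases hc : (α.bot : ℤ) ≤ -(v : ℤ) ∧ -(v : ℤ) ≤ α.top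
    · have hb := right_bounds hv
      have h1 := h v ⟨hb.1.le, hb.2.le⟩ (mem_Icc_neg.mpr hc)
      have h2 : α.side v = -1 := by simp [side, hv]
      left
      by_contra h3
      have h4 : v ∉ (-α).right := h3
      rw [h2] at h1
      simp only [side, h4, if_false] at h1
      split_ifs at h1 <;> omega
    · exact Or.inr hc
  refine ⟨ho.2, fun v hv hv' => ?_, fun hv => ?_, fun hv => ?_, fun e => absurd e hp.bot_ne⟩
  · rcases key v hv with h1 | h1
    · exact h1.2 hv'
    · have := right_bounds hv'
      rw [Pt.coe_neg] at this
      omega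
  · rcases key _ hv with h1 | h1
    · rw [Pt.neg_neg] at h1
      have := left_bounds h1
      omega
    · rw [Pt.coe_neg] at h1
      omega
  · rcases key _ hv with h1 | h1
    · rw [Pt.neg_neg] at h1
      have := left_bounds h1
      omega
    · rw [Pt.coe_neg] at h1
      omega

theorem isRestriction_iff : β.IsRestriction α ↔
    α.bot ≤ β.bot ∧ β.top ≤ α.top ∧ β.right = α.right ∩ Set.Ioo β.bot β.top := by
  constructor
  · rintro ⟨h1, h2, h3⟩
    refine ⟨h1, h2, Set.ext fun v => ⟨fun hv => ?_, fun hv => ?_⟩⟩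
    · have hb := right_bounds hv
      exact ⟨(h3 v hb.1 hb.2).mp hv, hb⟩
    · exact (h3 v hv.2.1 hv.2.2).mpr hv.1
  · rintro ⟨h1, h2, h3⟩
    refine ⟨h1, h2, fun v h4 h5 => ?_⟩
    rw [h3]
    exact ⟨fun h => h.1, fun h => ⟨h, h4, h5⟩⟩

theorem NonOverlapping.not_isOverlapping (h : α.NonOverlapping) : ¬α.IsOverlapping := by
  unfold NonOverlapping IsOverlapping at *
  omega

theorem nonOverlapping_or_isOverlapping (α : Arc n) : α.NonOverlapping ∨ α.IsOverlapping := by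
  unfold NonOverlapping IsOverlapping
  have := α.bot.ne_zero
  have := α.top.ne_zero
  omega

/-- The end of `α` nearer to the centre reflects to an inner point of `α`. It is left of `α` as `α`
is admissible, but would have to be right of it if `-α` were. -/
theorem Adm.not_adm_neg (h : α.Adm) (ho : α.IsOverlapping) (hs : (α.bot : ℤ) ≠ -α.top) :
    ¬(-α).Adm := by
  intro h'
  have e1 := Pt.coe_neg α.bot
  have e2 := Pt.coe_neg α.top
  have h1 := h'.neg_bot
  have h2 := h'.neg_top
  rw [mem_neg_right, Arc.neg_bot, Pt.neg_neg] at h1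
  rw [mem_neg_right, Arc.neg_top, Pt.neg_neg] at h2
  obtain ⟨h3, h4⟩ := ho
  by_cases h5 : -(α.bot : ℤ) < α.top
  · exact h2 (mem_left.mpr ⟨⟨by omega, by omega⟩, h.neg_bot⟩)
  · exact h1 (mem_left.mpr ⟨⟨by omega, by omega⟩, h.neg_top⟩)

theorem pair_neg (α : Arc n) : ({-α, - -α} : Set (Arc n)) = {α, -α} := by
  rw [neg_neg', Set.pair_comm]

/-- The arc diagram `{γ, -γ}` is a subarc or subarc pair of `{β, -β}` if `γ` is a subarc
of `β`. -/
theorem IsSub.isSubarcOrSubpair (h : γ.IsSub β) (hβ : β.Adm) :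
    IsSubarcOrSubpair {γ, -γ} {β, -β} := by
  by_cases hs : (β.bot : ℤ) = -β.top
  · have hβs := hβ.isSymm hs
    refine Or.inl ⟨β, hβs, by rw [hβs, Set.pair_eq_singleton], ?_⟩
    have key : ∀ δ : Arc n, 0 < (δ.bot : ℤ) → δ.IsRestriction β → δ.IsSubpairOfSymm β :=
      fun δ h1 h2 => ⟨NonOverlapping.isPair (Or.inl h1), h1, h2.2.1, (isRestriction_iff.mp h2).2.2⟩
    have key' : 0 < (γ.bot : ℤ) ∨ (γ.top : ℤ) < 0 ∨ (γ.Adm ∧ (γ.bot : ℤ) = -γ.top) := by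
      rcases h.2 with (h1 | h1) | h1
      · exact Or.inl h1
      · exact Or.inr (Or.inl h1)
      · exact Or.inr (Or.inr ⟨h1.1, h1.2 hs⟩)
    rcases key' with h1 | h1 | ⟨h1, h2⟩
    · exact Or.inr ⟨γ, rfl, key γ h1 h.1⟩
    · refine Or.inr ⟨-γ, (pair_neg γ).symm, key (-γ) ?_ ?_⟩
      · rw [Arc.neg_bot, Pt.coe_neg]; omega
      · have := h.1.neg
        rwa [hβs] at this
    · have hγs := h1.isSymm h2
      exact Or.inl ⟨γ, by rw [hγs, Set.pair_eq_singleton], hγs, h.1.2.1,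
        (isRestriction_iff.mp h.1).2.2⟩
  · refine Or.inr ⟨β, hβ.isPair hs, rfl, ?_⟩
    have hr := isRestriction_iff.mp h.1
    have key : γ.IsPair → (γ.IsOverlapping → IsRightOf γ (-γ)) → γ.IsSubpairOfPair β :=
      fun h1 h2 => ⟨h1, fun _ => hβ.isRightOf_neg, hr.1, hr.2.1, hr.2.2, h2⟩
    rcases h.2 with h1 | ⟨h1, -⟩
    · exact Or.inr ⟨γ, rfl, key h1.isPair fun h2 => absurd h2 h1.not_isOverlapping⟩
    · by_cases h2 : (γ.bot : ℤ) = -γ.top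
      · have hγs := h1.isSymm h2
        refine Or.inl ⟨γ, by rw [hγs, Set.pair_eq_singleton], hγs, hr.1, hr.2.1, hr.2.2,
          Set.ext fun v => ?_⟩
        obtain ⟨h3, h4, h5⟩ := h.1
        have h6 := h5 (-v)
        rw [Pt.coe_neg] at h6
        constructor
        · intro hv
          have hb := right_bounds hv
          refine ⟨⟨⟨?_, ?_⟩, ?_⟩, hb⟩
          · rw [Pt.lt_iff, Pt.coe_neg]; omega
          · rw [Pt.lt_iff, Pt.coe_neg]; omega
          · exact fun h7 => h1.neg_right v hv ((h6 (by omega) (by omega)).mpr h7)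
        · rintro ⟨hv, hb⟩
          have hb' : (γ.bot : ℤ) < v ∧ (v : ℤ) < γ.top := hb
          refine (h1.symm h2 v hb'.1 hb'.2).resolve_right fun h7 => ?_
          exact hv.2 ((h6 (by omega) (by omega)).mp h7)
      · exact Or.inr ⟨γ, rfl, key (h1.isPair h2) fun _ => h1.isRightOf_neg⟩

theorem eq_or_eq_neg_of_pair_eq (h : ({α, -α} : Set (Arc n)) = {γ, -γ}) : γ = α ∨ γ = -α := by
  have : γ ∈ ({α, -α} : Set (Arc n)) := h ▸ Set.mem_insert _ _
  exact this

theorem eq_of_pair_eq_singleton (h : ({α, -α} : Set (Arc n)) = {γ}) : α = γ := by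
  have : α ∈ ({γ} : Set (Arc n)) := h ▸ Set.mem_insert _ _
  exact this

theorem isSub_of_isSubarcOrSubpair (hβ : β.Adm)
    (h : IsSubarcOrSubpair {α, -α} {β, -β}) : α.IsSub β ∨ (-α).IsSub β := by
  have hpm : ∀ γ : Arc n, ({α, -α} : Set (Arc n)) = {γ, -γ} → γ.IsSub β ∨ (-γ).IsSub β →
      α.IsSub β ∨ (-α).IsSub β := by
    intro γ h1 h2
    rcases eq_or_eq_neg_of_pair_eq h1 with rfl | rfl
    · exact h2
    · rw [neg_neg'] at h2
      exact h2.symm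
  rcases h with ⟨δ, hδ, h2, h3⟩ | ⟨δ, hδ, h2, h3⟩
  · have := eq_of_pair_eq_singleton h2
    subst this
    have hs := hδ.bot_eq
    rcases h3 with ⟨γ, h1, hγ, h4, h5⟩ | ⟨γ, h1, -, h0, h4, h5⟩
    · have := eq_of_pair_eq_singleton h1
      subst this
      have hs' := hγ.bot_eq
      rw [Pt.le_iff] at h4
      exact Or.inl ⟨isRestriction_iff.mpr ⟨by rw [Pt.le_iff]; omega, h4, h5⟩,
        Or.inr ⟨hγ.adm, fun _ => hs'⟩⟩
    · refine hpm γ h1 (Or.inl ⟨isRestriction_iff.mpr ⟨?_, h4, h5⟩, Or.inl (Or.inl h0)⟩)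
      have := hβ.top_pos
      rw [Pt.le_iff]
      omega
  · have hne : (β.bot : ℤ) ≠ -β.top := by
      have := hδ.bot_ne
      rcases eq_or_eq_neg_of_pair_eq h2 with rfl | rfl
      · exact this
      · rw [Arc.neg_bot, Arc.neg_top, Pt.coe_neg, Pt.coe_neg] at this
        omega
    have hd := eq_or_eq_neg_of_pair_eq h2
    rcases h3 with ⟨γ, h1, hγ, h4, h5, h6, -⟩ | ⟨γ, h1, hγ, hδo, h4, h5, h6, hγo⟩
    · have := eq_of_pair_eq_singleton h1
      subst this
      have hr : α.IsRestriction δ := isRestriction_iff.mpr ⟨h4, h5, h6⟩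
      refine Or.inl ⟨?_, Or.inr ⟨hγ.adm, fun e => absurd e hne⟩⟩
      rcases hd with rfl | rfl
      · exact hr
      · have := hr.neg
        rwa [neg_neg', hγ] at this
    · have hr : γ.IsRestriction δ := isRestriction_iff.mpr ⟨h4, h5, h6⟩
      refine hpm γ h1 ?_
      rcases nonOverlapping_or_isOverlapping γ with hn | ho
      · rcases hd with rfl | rfl
        · exact Or.inl ⟨hr, Or.inl hn⟩
        · have := hr.neg
          rw [neg_neg'] at this
          exact Or.inr ⟨this, Or.inl hn.neg⟩
      · have ho' : δ.IsOverlapping := by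
          have h7 := hr.1
          have h8 := hr.2.1
          unfold IsOverlapping at *
          omega
        have hδA := (hδo ho').adm ho' hδ
        rcases hd with rfl | rfl
        · exact Or.inl ⟨hr, Or.inr ⟨(hγo ho).adm ho hγ, fun e => absurd e hne⟩⟩
        -- Both `β` and `-β` would be the right arc of an overlapping pair.
        · refine absurd hδA (hβ.not_adm_neg ?_ hne)
          unfold IsOverlapping at *
          rw [Arc.neg_bot, Arc.neg_top, Pt.coe_neg, Pt.coe_neg] at ho'
          omega

theorem isSubarcOrSubpair_iff (hβ : β.Adm) :
    IsSubarcOrSubpair {α, -α} {β, -β} ↔ α.IsSub β ∨ (-α).IsSub β := by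
  refine ⟨isSub_of_isSubarcOrSubpair hβ, ?_⟩
  rintro (h | h)
  · exact h.isSubarcOrSubpair hβ
  · rw [← pair_neg]
    exact h.isSubarcOrSubpair hβ

end Arc

end TypeB

theorem mainTheorem1 (n : ℕ) (j₁ j₂ : TypeB.SignedPerm n)
    (h₁ : Forcing.IsJoinIrred j₁) (h₂ : Forcing.IsJoinIrred j₂) :
    Forcing.Forces j₁ j₂ ↔
      TypeB.IsSubarcOrSubpair (TypeB.arcDiagram j₁) (TypeB.arcDiagram j₂) := by
  obtain ⟨α, hα, hj₁⟩ := TypeB.exists_adm_of_isJoinIrred h₁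
  obtain ⟨β, hβ, hj₂⟩ := TypeB.exists_adm_of_isJoinIrred h₂
  rw [hα.arcDiagram_eq hj₁, hβ.arcDiagram_eq hj₂, hα.forces_iff hβ hj₁ hj₂,
    TypeB.Arc.isSubarcOrSubpair_iff hβ]
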